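/- Let $F$ be an ordered field, $M$ an ordered $F$-vector space with a distinguished element $1>0$, and $Q\subsetneq M$ a proper $F$-subspace with $1\in Q$ that is dense in $M$ (for all $a<b$ in $M$ there is $q\in Q$ with $a<q<b$). Let $\mathcal L^\star$ be the two-sorted language with $+,<,0,1$, the scalar multiplications $(x\mapsto\alpha x)_{\alpha\in F}$ and a unary predicate $Q$ on the home sort, a function symbol $\pi$ from the home sort to the quotient sort, and addition $+_Q$ and scalar multiplications $(x\mapsto \alpha_Q x)_{\alpha\in F}$ on the quotient sort. Let $T_{POVS}$ be the complete $\mathcal L^\star$-theory of $(M,M/Q)$, where $\pi$ is the quotient map and all symbols have their natural interpretation. Let $\mathcal N$ be any model of $T_{POVS}$ (for example $(M,M/Q)$ itself). (1) For every binary relation $\prec$ on the quotient sort of $\mathcal N$ such that the quotient sort with $+_Q$, $(x\mapsto\alpha_Q x)_{\alpha\in F}$ and $\prec$ is a densely ordered $F$-vector space, the complete $\mathcal L^\star\cup\{\prec\}$-theory of $(\mathcal N,\prec)$ is distal. (2) Such a relation $\prec$ exists; thus $\mathcal N$ has an expansion with a distal theory. Here a theory $T$ is distal if for every model $\mathcal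 U$ of $T$, all infinite linear orders $I_1,I_2$ without endpoints, every indiscernible sequence $(a_i)_{i\in I_1+(c)+I_2}$ of tuples of $\mathcal U$ in some fixed finite tuple of sorts, and every finite tuple $b$ of elements of $\mathcal U$: $(a_i)_{i\in I_1+I_2}$ is indiscernible over $b$ if and only if $(a_i)_{i\in I_1+(c)+I_2}$ is indiscernible over $b$. -/

import Mathlib

/-! ### Many-sorted first-order logic -/

namespace ManySorted

universe u v w x y z

/-- A many-sorted first-order language. -/
structure Lang where
  /-- the sorts -/
  Sorts : Type u
  /-- the function symbols (constants are the function symbols of arity `0`) -/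
  Func : Type v
  /-- the relation symbols -/
  Rel : Type w
  funcArity : Func → ℕ
  funcDom : (f : Func) → Fin (funcArity f) → Sorts
  funcCod : Func → Sorts
  relArity : Rel → ℕ
  relDom : (r : Rel) → Fin (relArity r) → Sorts

/-- The language `L` with one further relation symbol, binary on the sort `s`. -/
def Lang.addBinary (L : Lang.{u, v, w}) (s : L.Sorts) :
    Lang.{u, v, w} where
  Sorts := L.Sorts
  Func := L.Func
  Rel := Option L.Rel
  funcArity := L.funcArity
  funcDom := L.funcDom
  funcCod := L.funcCod
  relArity
    | none => 2
    | some r => L.relArity r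
  relDom
    | none => fun _ => s
    | some r => L.relDom r

/-- A structure for a many-sorted language. -/
structure Struct (L : Lang.{u, v, w}) where
  carrier : L.Sorts → Type x
  funMap : (f : L.Func) → ((i : Fin (L.funcArity f)) → carrier (L.funcDom f i)) →
    carrier (L.funcCod f)
  relMap : (r : L.Rel) → ((i : Fin (L.relArity r)) → carrier (L.relDom r i)) → Prop

/-- Terms whose variables are the elements `i` of `V`, with `i` of sort `τ i`. -/
inductive Term (L : Lang.{u, v, w}) {V : Type} (τ : V → L.Sorts) : L.Sorts → Type (max u v)
  | var (i : V) : Term L τ (τ i)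
  | app (f : L.Func) (ts : (i : Fin (L.funcArity f)) → Term L τ (L.funcDom f i)) :
      Term L τ (L.funcCod f)

/-- The context `τ` with one further variable `none`, of sort `s`. -/
def extend {S : Type u} {V : Type} (τ : V → S) (s : S) : Option V → S
  | none => s
  | some i => τ i

/-- First-order formulas with free variables among the elements `i` of `V`, with `i` of sort
`τ i`. -/
inductive Formula (L : Lang.{u, v, w}) :
    {V : Type} → (V → L.Sorts) → Type (max 1 u v w)
  | falsum {V : Type} {τ : V → L.Sorts} : Formula L τ
  | equal {V : Type} {τ : V → L.Sorts} {s : L.Sorts} (t₁ t₂ : Term L τ s) : Formula L τ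
  | rel {V : Type} {τ : V → L.Sorts} (r : L.Rel)
      (ts : (i : Fin (L.relArity r)) → Term L τ (L.relDom r i)) : Formula L τ
  | imp {V : Type} {τ : V → L.Sorts} (φ ψ : Formula L τ) : Formula L τ
  | all {V : Type} {τ : V → L.Sorts} (s : L.Sorts) (φ : Formula L (extend τ s)) : Formula L τ

namespace Struct

variable {L : Lang.{u, v, w}}

/-- Extension of an assignment by a value for the new variable. -/
def extendVal (N : Struct.{u, v, w, x} L) {V : Type} {τ : V → L.Sorts} {s : L.Sorts}
    (e : (i : V) → N.carrier (τ i)) (a : N.carrier s) :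
    (i : Option V) → N.carrier (extend τ s i)
  | none => a
  | some i => e i

end Struct

/-- The value of a term under an assignment. -/
def Term.eval {L : Lang.{u, v, w}} (N : Struct.{u, v, w, x} L) {V : Type}
    {τ : V → L.Sorts} (e : (i : V) → N.carrier (τ i)) :
    {s : L.Sorts} → Term L τ s → N.carrier s
  | _, .var i => e i
  | _, .app f ts => N.funMap f (fun i => (ts i).eval N e)

/-- Satisfaction of a formula under an assignment. -/
def Formula.Realize {L : Lang.{u, v, w}} (N : Struct.{u, v, w, x} L) :
    {V : Type} → {τ : V → L.Sorts} → Formula L τ → ((i : V) → N.carrier (τ i)) → Prop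
  | _, _, .falsum, _ => False
  | _, _, .equal t₁ t₂, e => t₁.eval N e = t₂.eval N e
  | _, _, .rel r ts, e => N.relMap r (fun i => (ts i).eval N e)
  | _, _, .imp φ ψ, e => φ.Realize N e → ψ.Realize N e
  | _, _, .all s φ, e => ∀ a : N.carrier s, φ.Realize N (N.extendVal e a)

/-- Sentences: formulas without free variables. -/
abbrev Sentence (L : Lang.{u, v, w}) : Type (max 1 u v w) :=
  Formula L (Empty.elim : Empty → L.Sorts)

/-- A theory is a set of sentences. -/
abbrev Theory (L : Lang.{u, v, w}) : Type (max 1 u v w) := Set (Sentence L)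

namespace Struct

variable {L : Lang.{u, v, w}}

/-- Truth of a sentence in a structure. -/
def Satisfies (N : Struct.{u, v, w, x} L) (φ : Sentence L) : Prop :=
  φ.Realize N (fun i => i.elim)

/-- `N` is a model of `T`. -/
def IsModel (N : Struct.{u, v, w, x} L) (T : Theory L) : Prop :=
  ∀ φ ∈ T, N.Satisfies φ

/-- The complete theory of a structure. -/
def theory (N : Struct.{u, v, w, x} L) : Theory L := {φ | N.Satisfies φ}

/-- The assignment with value `a (i p) q` at the `q`-th variable of the `p`-th block and with
value `b j` at the `j`-th parameter variable. -/
def blockVal (N : Struct.{u, v, w, x} L) {I : Type y} {m k n : ℕ} {σ : Fin m → L.Sorts}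
    {ρ : Fin k → L.Sorts} (a : I → (j : Fin m) → N.carrier (σ j))
    (b : (j : Fin k) → N.carrier (ρ j)) (i : Fin n → I) :
    (p : (Fin n × Fin m) ⊕ Fin k) →
      N.carrier (Sum.elim (fun q : Fin n × Fin m => σ q.2) ρ p)
  | .inl q => a (i q.1) q.2
  | .inr j => b j

/-- The sequence `a` of `m`-tuples (in the finite tuple `σ` of sorts), indexed by the linear order
`I`, is indiscernible over the finite tuple `b` of parameters. -/
def IndiscernibleOver (N : Struct.{u, v, w, x} L) {I : Type y} [LinearOrder I] {m k : ℕ}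
    {σ : Fin m → L.Sorts} {ρ : Fin k → L.Sorts} (a : I → (j : Fin m) → N.carrier (σ j))
    (b : (j : Fin k) → N.carrier (ρ j)) : Prop :=
  ∀ (n : ℕ) (φ : Formula L (Sum.elim (fun q : Fin n × Fin m => σ q.2) ρ)) (i i' : Fin n → I),
    StrictMono i → StrictMono i' →
      (φ.Realize N (N.blockVal a b i) ↔ φ.Realize N (N.blockVal a b i'))

/-- Indiscernibility over the empty set. -/
def Indiscernible (N : Struct.{u, v, w, x} L) {I : Type y} [LinearOrder I] {m : ℕ}
    {σ : Fin m → L.Sorts} (a : I → (j : Fin m) → N.carrier (σ j)) : Prop :=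
  N.IndiscernibleOver (ρ := (Fin.elim0 : Fin 0 → L.Sorts)) a (fun j => j.elim0)

/-- The expansion of `N` by the binary relation `R` on the sort `s`. -/
def addBinary (N : Struct.{u, v, w, x} L) (s : L.Sorts)
    (R : N.carrier s → N.carrier s → Prop) : Struct.{u, v, w, x} (L.addBinary s) where
  carrier := N.carrier
  funMap := N.funMap
  relMap
    | none => fun e => R (e (0 : Fin 2)) (e (1 : Fin 2))
    | some r => N.relMap r

end Struct

/-- The inclusion of `I₁ + I₂` into `I₁ + (c) + I₂`. -/
def skip {I₁ : Type y} {I₂ : Type z} : I₁ ⊕ₗ I₂ → I₁ ⊕ₗ (Unit ⊕ₗ I₂) := fun i =>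
  match ofLex i with
  | .inl i => Sum.inlₗ i
  | .inr i => Sum.inrₗ (Sum.inrₗ i)

/-- The theory `T` is distal: in every model of `T`, for every sequence `(a_i)` of finite tuples
indexed by `I₁ + (c) + I₂` (with `I₁`, `I₂` infinite linear orders without endpoints) that is
indiscernible, and all parameters `b`, the sequence with `a_c` removed is indiscernible over `b`
if and only if the full sequence is. -/
def Theory.IsDistal {L : Lang.{u, v, w}} (T : Theory L) : Prop :=
  ∀ U : Struct.{u, v, w, x} L, U.IsModel T →
    ∀ (I₁ : Type y) (I₂ : Type z) [LinearOrder I₁] [LinearOrder I₂]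
      [Infinite I₁] [NoMinOrder I₁] [NoMaxOrder I₁]
      [Infinite I₂] [NoMinOrder I₂] [NoMaxOrder I₂]
      (m : ℕ) (σ : Fin m → L.Sorts) (a : I₁ ⊕ₗ (Unit ⊕ₗ I₂) → (j : Fin m) → U.carrier (σ j)),
      U.Indiscernible a →
        ∀ (k : ℕ) (ρ : Fin k → L.Sorts) (b : (j : Fin k) → U.carrier (ρ j)),
          U.IndiscernibleOver (a ∘ skip) b ↔ U.IndiscernibleOver a b

end ManySorted

/-! ### Dense pairs of ordered vector spaces -/

namespace DensePair

open ManySorted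

universe u x

/-- The home sort and the quotient sort. -/
inductive Srt : Type
  | home
  | quot

/-- `0`, `1`, `+` and the scalar multiplications on the home sort, the quotient map, and addition
and the scalar multiplications on the quotient sort. -/
inductive Fn (F : Type u) : Type u
  | zero
  | one
  | add
  | smul (α : F)
  | proj
  | qadd
  | qsmul (α : F)

/-- The order of the home sort and the predicate for the subspace. -/
inductive Rl : Type
  | lt
  | mem

/-- The two-sorted language `L*` of pairs of ordered `F`-vector spaces with a quotient sort. -/
def LStar (F : Type u) : Lang.{0, u, 0} where
  Sorts := Srt
  Func := Fn F
  Rel := Rl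
  funcArity
    | .zero => 0
    | .one => 0
    | .add => 2
    | .smul _ => 1
    | .proj => 1
    | .qadd => 2
    | .qsmul _ => 1
  funcDom
    | .zero => fun _ => .home
    | .one => fun _ => .home
    | .add => fun _ => .home
    | .smul _ => fun _ => .home
    | .proj => fun _ => .home
    | .qadd => fun _ => .quot
    | .qsmul _ => fun _ => .quot
  funcCod
    | .zero => .home
    | .one => .home
    | .add => .home
    | .smul _ => .home
    | .proj => .quot
    | .qadd => .quot
    | .qsmul _ => .quot
  relArity
    | .lt => 2
    | .mem => 1
  relDom
    | .lt => fun _ => .home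
    | .mem => fun _ => .home

section

variable {F : Type u} [Field F]

/-- The carriers of the two sorts: `M` and `M / Q`. -/
def pairCarrier {M : Type x} [AddCommGroup M] [Module F M] (Q : Submodule F M) : Srt → Type x
  | .home => M
  | .quot => M ⧸ Q

/-- The `L*`-structure `(M, M/Q; +, <, 0, 1, (α), Q, π, +_Q, (α_Q))`. -/
def pairStruct {M : Type x} [AddCommGroup M] [LT M] [Module F M] (one : M) (Q : Submodule F M) :
    Struct.{0, u, 0, x} (LStar F) where
  carrier := pairCarrier Q
  funMap
    | .zero => fun _ => (0 : M)
    | .one => fun _ => one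
    | .add => fun e : Fin 2 → M => e 0 + e 1
    | .smul α => fun e : Fin 1 → M => α • e 0
    | .proj => fun e : Fin 1 → M => Q.mkQ (e 0)
    | .qadd => fun e : Fin 2 → M ⧸ Q => e 0 + e 1
    | .qsmul α => fun e : Fin 1 → M ⧸ Q => α • e 0
  relMap
    | .lt => fun e : Fin 2 → M => e 0 < e 1
    | .mem => fun e : Fin 1 → M => e 0 ∈ Q

/-- The set `X` with the operations `add`, `smul` and the relation `lt` is a densely ordered
`F`-vector space. -/
def IsDenselyOrderedVectorSpace (F : Type u) [Field F] [LinearOrder F] {X : Type x}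
    (add : X → X → X) (smul : F → X → X) (lt : X → X → Prop) : Prop :=
  ∃ (_ : AddCommGroup X) (_ : Module F X) (_ : LinearOrder X),
    IsOrderedAddMonoid X ∧ IsStrictOrderedModule F X ∧ DenselyOrdered X ∧
      (∀ p q : X, add p q = p + q) ∧ (∀ (α : F) (p : X), smul α p = α • p) ∧
        ∀ p q : X, lt p q ↔ p < q

/-- The interpretation of `+_Q` in an `L*`-structure. -/
def qadd (N : Struct.{0, u, 0, x} (LStar F)) (p q : N.carrier Srt.quot) : N.carrier Srt.quot :=
  N.funMap Fn.qadd (Fin.cons (α := fun _ : Fin 2 => N.carrier Srt.quot) p (fun _ : Fin 1 => q))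

/-- The interpretation of `α_Q` in an `L*`-structure. -/
def qsmul (N : Struct.{0, u, 0, x} (LStar F)) (α : F) (p : N.carrier Srt.quot) :
    N.carrier Srt.quot :=
  N.funMap (Fn.qsmul α) (fun _ : Fin 1 => p)

end

/-- `prec` makes the quotient sort of `N`, with `+_Q` and the maps `α_Q`, a densely ordered
`F`-vector space. -/
def OrdersQuotient {F : Type u} [Field F] [LinearOrder F] (N : Struct.{0, u, 0, x} (LStar F))
    (prec : N.carrier Srt.quot → N.carrier Srt.quot → Prop) : Prop :=
  IsDenselyOrderedVectorSpace F (qadd N) (qsmul N) prec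

/-- The expansion of `N` to the language `L* ∪ {≺}`, with `≺` interpreted by `prec`. -/
def expand {F : Type u} (N : Struct.{0, u, 0, x} (LStar F))
    (prec : N.carrier Srt.quot → N.carrier Srt.quot → Prop) :
    Struct.{0, u, 0, x} ((LStar F).addBinary Srt.quot) :=
  N.addBinary Srt.quot prec

end DensePair

universe u x x' w y z

/-! Once `≺` is added, both sorts are nontrivial ordered `F`-vector spaces joined by a linear map,
and every fibre of that map is dense in the home sort: `Q` is dense, and the fibres are its
translates. The two orders interact in no other way. These facts are first-order, so they pass from
`(M, M/Q)` to `N` and from `(N, ≺)` to every model of its theory.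

They yield quantifier elimination in semantic form (`signDetermined_realize`): the truth of a
formula depends only on the signs of finitely many terms. The quantifier step is the extension
property `exists_same_signs`. A home element either equals one of finitely many thresholds, and then
its image is forced, or it lies in an open interval between thresholds, where density of the fibres
allows its image to be prescribed freely.

Distality is then a question about the sign of one term. Such a term splits as `f(a_i) + g(b)`
(`term_split`). Indiscernibility of the full sequence fixes the order type of the values of `f`, so
moving the index `c` slightly down and slightly up changes `f` in opposite directions, or not at all
(`exists_tuples_avoiding`). Hence `f(a_i)` lies between two values at tuples avoiding `c`. After
adding `g(b)` those two values have equal sign, by indiscernibility over `b` of the sequence without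
`a_c`, and the value in between shares it.

A suitable `≺` exists because any vector space over an ordered field can be ordered
lexicographically along a basis. -/

namespace ManySorted

-- Substitution, and transfer along an expansion by the empty relation.

universe v

/-- Simultaneous substitution of terms for variables. -/
def Term.subst {L : Lang.{u, v, w}} {V W : Type} {τ : V → L.Sorts} {τ' : W → L.Sorts}
    (g : (i : V) → Term L τ' (τ i)) : {s : L.Sorts} → Term L τ s → Term L τ' s
  | _, .var i => g i
  | _, .app f ts => .app f (fun i => (ts i).subst g)

theorem Term.eval_subst {L : Lang.{u, v, w}} (N : Struct.{u, v, w, x} L) {V W : Type}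
    {τ : V → L.Sorts} {τ' : W → L.Sorts} (g : (i : V) → Term L τ' (τ i))
    (e : (i : W) → N.carrier (τ' i)) {s : L.Sorts} (t : Term L τ s) :
    (t.subst g).eval N e = t.eval N (fun i => (g i).eval N e) := by
  induction t with
  | var i => rfl
  | app f ts ih =>
    simp only [Term.subst, Term.eval]
    exact congrArg _ (funext fun i => ih i)

/-- The term of the reduced language with the same symbols. -/
def Term.lower {L : Lang.{u, v, w}} {r : L.Sorts} {V : Type} {τ : V → L.Sorts} :
    {s : L.Sorts} → Term (L.addBinary r) τ s → Term L τ s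
  | _, .var i => .var i
  | _, .app f ts => .app (L := L) f (fun i => (ts i).lower)

theorem Term.eval_lower {L : Lang.{u, v, w}} {r : L.Sorts} (N : Struct.{u, v, w, x} L)
    (R : N.carrier r → N.carrier r → Prop) {V : Type} {τ : V → L.Sorts}
    (e : (i : V) → N.carrier (τ i)) : {s : L.Sorts} → (t : Term (L.addBinary r) τ s) →
    (Term.lower (L := L) (r := r) t).eval N e = Term.eval (N.addBinary r R) e t
  | _, .var _ => rfl
  | _, .app f ts => congrArg (N.funMap f) (funext fun i => Term.eval_lower N R e (ts i))

/-- The formula in which the atoms of the additional relation symbol are replaced by `⊥`. -/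
def Formula.lower {L : Lang.{u, v, w}} {r : L.Sorts} : {V : Type} → {τ : V → L.Sorts} →
    Formula (L.addBinary r) τ → Formula L τ
  | _, _, .falsum => .falsum
  | _, _, .equal t₁ t₂ => .equal t₁.lower t₂.lower
  | _, _, .rel none _ => .falsum
  | _, _, .rel (some q) ts => .rel q (fun i => (ts i).lower)
  | _, _, .imp φ ψ => .imp φ.lower ψ.lower
  | _, _, .all s φ => .all (L := L) s φ.lower

theorem Formula.realize_lower {L : Lang.{u, v, w}} {r : L.Sorts} (N : Struct.{u, v, w, x} L) :
    {V : Type} → {τ : V → L.Sorts} → (φ : Formula (L.addBinary r) τ) →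
    (e : (i : V) → N.carrier (τ i)) → ((Formula.lower (L := L) (r := r) φ).Realize N e ↔
      Formula.Realize (N.addBinary r fun _ _ => False) φ e)
  | _, _, .falsum, _ => Iff.rfl
  | _, _, .equal t₁ t₂, e => iff_of_eq (congrArg₂ Eq (Term.eval_lower N (fun _ _ => False) e t₁)
      (Term.eval_lower N (fun _ _ => False) e t₂))
  | _, _, .rel none _, _ => Iff.rfl
  | _, _, .rel (some q) ts, e => iff_of_eq (congrArg (N.relMap q)
      (funext fun i => Term.eval_lower N (fun _ _ => False) e (ts i)))
  | _, _, .imp φ ψ, e => imp_congr (Formula.realize_lower N φ e) (Formula.realize_lower N ψ e)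
  | _, _, .all _ φ, e => forall_congr' fun a => Formula.realize_lower N φ (N.extendVal e a)

/-- Elementary equivalence passes to expansions by an empty relation. -/
theorem Struct.satisfies_addBinary_empty {L : Lang.{u, v, w}} (r : L.Sorts)
    {N : Struct.{u, v, w, x} L} {N' : Struct.{u, v, w, x'} L} (h : N'.IsModel N.theory)
    (φ : Sentence (L.addBinary r)) (hφ : (N.addBinary r fun _ _ => False).Satisfies φ) :
    (N'.addBinary r fun _ _ => False).Satisfies φ := by
  have h₁ : (Formula.lower φ).Realize N _ := (Formula.realize_lower N φ _).2 hφ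
  have h₂ : N'.Satisfies (Formula.lower φ) := h (Formula.lower φ) h₁
  exact (Formula.realize_lower N' φ _).1 h₂

end ManySorted

/-! ### Terms, atomic formulas and their interpretation in the two sorts. -/

namespace DensePair

open ManySorted

/-- The language of pairs with an additional order symbol on the quotient sort. -/
abbrev LPrec (F : Type u) : Lang.{0, u, 0} := (LStar F).addBinary Srt.quot

section Terms

variable {F : Type u} {V : Type} {τ : V → Srt}

/-- The sum of two terms of the same sort. -/
def tadd : (s : Srt) → (t₁ t₂ : Term (LPrec F) τ s) → Term (LPrec F) τ s
  | .home, t₁, t₂ => .app (L := LPrec F) Fn.add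
      (Fin.cons (α := fun _ : Fin 2 => Term (LPrec F) τ Srt.home) t₁ (fun _ : Fin 1 => t₂))
  | .quot, t₁, t₂ => .app (L := LPrec F) Fn.qadd
      (Fin.cons (α := fun _ : Fin 2 => Term (LPrec F) τ Srt.quot) t₁ (fun _ : Fin 1 => t₂))

/-- A scalar multiple of a term. -/
def tsmul (α : F) : (s : Srt) → Term (LPrec F) τ s → Term (LPrec F) τ s
  | .home, t => .app (L := LPrec F) (Fn.smul α) (fun _ : Fin 1 => t)
  | .quot, t => .app (L := LPrec F) (Fn.qsmul α) (fun _ : Fin 1 => t)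

/-- The image of a term under the quotient map. -/
def tproj (t : Term (LPrec F) τ Srt.home) : Term (LPrec F) τ Srt.quot :=
  .app (L := LPrec F) Fn.proj (fun _ : Fin 1 => t)

/-- The term for the zero vector of a sort. -/
def tzero : (s : Srt) → Term (LPrec F) τ s
  | .home => .app (L := LPrec F) Fn.zero (fun i : Fin 0 => i.elim0)
  | .quot => tproj (.app (L := LPrec F) Fn.zero (fun i : Fin 0 => i.elim0))

/-- The atomic formula comparing two terms of the same sort. -/
def flt : (s : Srt) → (t₁ t₂ : Term (LPrec F) τ s) → Formula (LPrec F) τ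
  | .home, t₁, t₂ => .rel (L := LPrec F) (some Rl.lt)
      (Fin.cons (α := fun _ : Fin 2 => Term (LPrec F) τ Srt.home) t₁ (fun _ : Fin 1 => t₂))
  | .quot, t₁, t₂ => .rel (L := LPrec F) none
      (Fin.cons (α := fun _ : Fin 2 => Term (LPrec F) τ Srt.quot) t₁ (fun _ : Fin 1 => t₂))

/-- The atomic formula for membership in the subspace. -/
def fmem (t : Term (LPrec F) τ Srt.home) : Formula (LPrec F) τ :=
  .rel (L := LPrec F) (some Rl.mem) (fun _ : Fin 1 => t)

end Terms

section Operations

variable {F : Type u} (U : Struct.{0, u, 0, w} (LPrec F))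

/-- The universe of the sort `s`. -/
abbrev Car (s : Srt) : Type w := U.carrier s

/-- Addition on the sort `s`. -/
def uadd : (s : Srt) → Car U s → Car U s → Car U s
  | .home, p, q => U.funMap Fn.add
      (Fin.cons (α := fun _ : Fin 2 => Car U Srt.home) p (fun _ : Fin 1 => q))
  | .quot, p, q => U.funMap Fn.qadd
      (Fin.cons (α := fun _ : Fin 2 => Car U Srt.quot) p (fun _ : Fin 1 => q))

/-- Scalar multiplication on the sort `s`. -/
def usmul (α : F) : (s : Srt) → Car U s → Car U s
  | .home, p => U.funMap (Fn.smul α) (fun _ : Fin 1 => p)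
  | .quot, p => U.funMap (Fn.qsmul α) (fun _ : Fin 1 => p)

/-- The quotient map. -/
def uproj (p : Car U Srt.home) : Car U Srt.quot := U.funMap Fn.proj (fun _ : Fin 1 => p)

/-- The zero vector of the sort `s`. -/
def uzero : (s : Srt) → Car U s
  | .home => U.funMap Fn.zero (fun i : Fin 0 => i.elim0)
  | .quot => uproj U (U.funMap Fn.zero (fun i : Fin 0 => i.elim0))

/-- The order of the sort `s`. -/
def ult : (s : Srt) → Car U s → Car U s → Prop
  | .home, p, q => U.relMap (some Rl.lt)
      (Fin.cons (α := fun _ : Fin 2 => Car U Srt.home) p (fun _ : Fin 1 => q))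
  | .quot, p, q => U.relMap none
      (Fin.cons (α := fun _ : Fin 2 => Car U Srt.quot) p (fun _ : Fin 1 => q))

/-- The predicate for the subspace. -/
def umem (p : Car U Srt.home) : Prop := U.relMap (some Rl.mem) (fun _ : Fin 1 => p)

variable {V : Type} {τ : V → Srt} (e : (i : V) → Car U (τ i))

theorem eval_tadd (s : Srt) (t₁ t₂ : Term (LPrec F) τ s) :
    (tadd s t₁ t₂).eval U e = uadd U s (t₁.eval U e) (t₂.eval U e) := by
  cases s
  all_goals
    refine congrArg (U.funMap _) (funext fun i : Fin 2 => ?_)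
    refine Fin.cases ?_ (fun _ => ?_) i <;> rfl

theorem eval_tsmul (α : F) (s : Srt) (t : Term (LPrec F) τ s) :
    (tsmul α s t).eval U e = usmul U α s (t.eval U e) := by
  cases s <;> rfl

theorem eval_tproj (t : Term (LPrec F) τ Srt.home) :
    (tproj t).eval U e = uproj U (t.eval U e) := rfl

theorem eval_tzero (s : Srt) : (tzero s : Term (LPrec F) τ s).eval U e = uzero U s := by
  have h : (fun i => Term.eval U e ((fun i : Fin 0 => i.elim0 :
      (i : Fin 0) → Term (LPrec F) τ Srt.home) i)) = (fun i : Fin 0 => i.elim0) :=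
    funext fun i => i.elim0
  cases s
  · exact congrArg (U.funMap Fn.zero) h
  · exact congrArg (fun f => uproj U (U.funMap Fn.zero f)) h

theorem realize_flt (s : Srt) (t₁ t₂ : Term (LPrec F) τ s) :
    (flt s t₁ t₂).Realize U e ↔ ult U s (t₁.eval U e) (t₂.eval U e) := by
  cases s
  all_goals
    refine iff_of_eq (congrArg (U.relMap _) (funext fun i : Fin 2 => ?_))
    refine Fin.cases ?_ (fun _ => ?_) i <;> rfl

theorem realize_fmem (t : Term (LPrec F) τ Srt.home) :
    (fmem t).Realize U e ↔ umem U (t.eval U e) := Iff.rfl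

end Operations

end DensePair

/-! ### Signs, cuts and orders in vector spaces over an ordered field. -/

section OrderedVectorSpaces

variable {F : Type u} [Field F] [LinearOrder F] [IsStrictOrderedRing F]

theorem isStrictOrderedModule_of_smul_lt_smul {X : Type x} [AddCommGroup X] [LinearOrder X]
    [IsOrderedAddMonoid X] [Module F X]
    (h : ∀ (α : F) (p q : X), 0 < α → p < q → α • p < α • q) : IsStrictOrderedModule F X where
  smul_lt_smul_of_pos_left α hα p q hpq := h α p q hα hpq
  smul_lt_smul_of_pos_right p hp α β hαβ := by
    -- Monotonicity in the scalar is monotonicity in the vector, applied to `0 < p` with scalar `β -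
    -- α`.
    have := h (β - α) 0 p (sub_pos.2 hαβ) hp
    rwa [smul_zero, sub_smul, sub_pos] at this

section

variable {X : Type x} [AddCommGroup X] [LinearOrder X] [IsOrderedAddMonoid X]

theorem denselyOrdered_of_isStrictOrderedModule (F : Type u) [Field F] [LinearOrder F]
    [IsStrictOrderedRing F]
    (X : Type x) [AddCommGroup X] [LinearOrder X] [IsOrderedAddMonoid X] [Module F X]
    [IsStrictOrderedModule F X] : DenselyOrdered X where
  dense p q hpq := by
    have h2 : (0 : F) < 2⁻¹ := by positivity
    have hd : (0 : X) < (2⁻¹ : F) • (q - p) := smul_pos h2 (sub_pos.2 hpq)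
    have hs : (2⁻¹ : F) • (q - p) + (2⁻¹ : F) • (q - p) = q - p := by
      rw [← add_smul, ← two_mul, mul_inv_cancel₀ two_ne_zero, one_smul]
    refine ⟨p + (2⁻¹ : F) • (q - p), lt_add_of_pos_right _ hd, ?_⟩
    calc p + (2⁻¹ : F) • (q - p) < p + ((2⁻¹ : F) • (q - p) + (2⁻¹ : F) • (q - p)) :=
          add_lt_add_right (lt_add_of_pos_right _ hd) p
      _ = q := by rw [hs]; abel

theorem sign_smul_eq [Module F X] [IsStrictOrderedModule F X] (α : F) (p : X) :
    SignType.sign (α • p) = SignType.sign α * SignType.sign p := by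
  rcases lt_trichotomy α 0 with hα | rfl | hα <;> rcases lt_trichotomy p 0 with hp | rfl | hp
  · rw [sign_neg hα, sign_neg hp, sign_pos (smul_pos_of_neg_of_neg hα hp)]; rfl
  · simp
  · rw [sign_neg hα, sign_pos hp, sign_neg (smul_neg_of_neg_of_pos hα hp)]; rfl
  · simp
  · simp
  · simp
  · rw [sign_pos hα, sign_neg hp, sign_neg (smul_neg_of_pos_of_neg hα hp)]; rfl
  · simp
  · rw [sign_pos hα, sign_pos hp, sign_pos (smul_pos hα hp)]; rfl

/-- The sign of an affine function at a point depends only on the position of the point relative to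
the zero of the function. -/
theorem sign_add_smul_congr [Module F X] [IsStrictOrderedModule F X] {α : F} {f f' p p' : X}
    (hf : SignType.sign f = SignType.sign f')
    (hp : SignType.sign (p - -(α⁻¹ • f)) = SignType.sign (p' - -(α⁻¹ • f'))) :
    SignType.sign (f + α • p) = SignType.sign (f' + α • p') := by
  -- For `α = 0` the value is `f` itself, so the hypothesis on the zero, with its default `0⁻¹ = 0`,
  -- plays no role.
  rcases eq_or_ne α 0 with rfl | hα
  · simpa using hf
  · have key : ∀ g r : X, g + α • r = α • (r - -(α⁻¹ • g)) := fun g r => by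
      rw [sub_neg_eq_add, smul_add, smul_smul, mul_inv_cancel₀ hα, one_smul, add_comm]
    rw [key, key, sign_smul_eq, sign_smul_eq, hp]

theorem lt_iff_of_sign_sub_eq {p q p' q' : X}
    (h : SignType.sign (p - q) = SignType.sign (p' - q')) : p < q ↔ p' < q' := by
  rw [← sub_neg, ← sign_eq_neg_one_iff, h, sign_eq_neg_one_iff, sub_neg]

/-- Two finite families of points of the same order type realize the same cuts; a cut that is not
one of the points contains an interval. -/
theorem exists_cut (F : Type u) [Field F] [LinearOrder F] [IsStrictOrderedRing F]
    [Module F X] [IsStrictOrderedModule F X] [Nontrivial X] {ι : Type*} [Finite ι] (P P' : ι → X)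
    (h : ∀ i j, SignType.sign (P i - P j) = SignType.sign (P' i - P' j)) (p : X) :
    (∃ i, p = P i) ∨ ∃ m₁ m₂, m₁ < m₂ ∧ ∀ p', m₁ < p' → p' < m₂ →
      ∀ j, SignType.sign (p - P j) = SignType.sign (p' - P' j) := by
  classical
  by_cases hp : ∃ i, p = P i
  · exact Or.inl hp
  refine Or.inr ?_
  push Not at hp
  have := denselyOrdered_of_isStrictOrderedModule F X
  have := Fintype.ofFinite ι
  let lo : Finset X := (Finset.univ.filter fun i => P i < p).image P'
  let hi : Finset X := (Finset.univ.filter fun i => p < P i).image P'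
  have hlo : ∀ i, P i < p → P' i ∈ lo := fun i hi =>
    Finset.mem_image_of_mem _ (Finset.mem_filter.2 ⟨Finset.mem_univ _, hi⟩)
  have hhi : ∀ i, p < P i → P' i ∈ hi := fun i hi =>
    Finset.mem_image_of_mem _ (Finset.mem_filter.2 ⟨Finset.mem_univ _, hi⟩)
  have hlh : ∀ r ∈ lo, ∀ s ∈ hi, r < s := by
    intro r hr s hs
    obtain ⟨i, hi, rfl⟩ := Finset.mem_image.1 hr
    obtain ⟨j, hj, rfl⟩ := Finset.mem_image.1 hs
    exact (lt_iff_of_sign_sub_eq (h i j)).1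
      ((Finset.mem_filter.1 hi).2.trans (Finset.mem_filter.1 hj).2)
  -- Either set may be empty; a nontrivial ordered vector space has no endpoints, so `m₁` and `m₂`
  -- exist in every case.
  obtain ⟨m₁, h₁, h₁'⟩ := Order.exists_between_finsets lo hi hlh
  obtain ⟨m₂, h₂, h₂'⟩ := Order.exists_between_finsets {m₁} hi (by simpa using h₁')
  refine ⟨m₁, m₂, h₂ m₁ (Finset.mem_singleton_self _), fun p' hp₁ hp₂ j => ?_⟩
  rcases lt_or_gt_of_ne (hp j) with hj | hj
  · rw [sign_neg (sub_neg.2 hj), sign_neg (sub_neg.2 (hp₂.trans (h₂' _ (hhi j hj))))]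
  · rw [sign_pos (sub_pos.2 hj), sign_pos (sub_pos.2 ((h₁ _ (hlo j hj)).trans hp₁))]

theorem exists_sign_sub_eq (F : Type u) [Field F] [LinearOrder F] [IsStrictOrderedRing F]
    [Module F X] [IsStrictOrderedModule F X] [Nontrivial X] {ι : Type*} [Finite ι] (P P' : ι → X)
    (h : ∀ i j, SignType.sign (P i - P j) = SignType.sign (P' i - P' j)) (p : X) :
    ∃ p', ∀ j, SignType.sign (p - P j) = SignType.sign (p' - P' j) := by
  rcases exists_cut F P P' h p with ⟨i, rfl⟩ | ⟨m₁, m₂, hm, H⟩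
  · exact ⟨P' i, h i⟩
  · have := denselyOrdered_of_isStrictOrderedModule F X
    obtain ⟨p', h₁, h₂⟩ := exists_between hm
    exact ⟨p', H p' h₁ h₂⟩

end

/-- Every vector space over an ordered field carries a compatible linear order. -/
theorem exists_linearOrder_isStrictOrderedModule (X : Type x) [AddCommGroup X] [Module F X] :
    ∃ _ : LinearOrder X, IsOrderedAddMonoid X ∧ IsStrictOrderedModule F X := by
  classical
  obtain ⟨ι, ⟨b⟩⟩ : ∃ ι : Type x, Nonempty (Module.Basis ι F X) :=
    ⟨_, ⟨Module.Basis.ofVectorSpace F X⟩⟩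
  let : LinearOrder ι := WellOrderingRel.isWellOrder.linearOrder
  let f : X → Lex (ι →₀ F) := fun p => toLex (b.repr p)
  have hf : Function.Injective f := fun p q h => b.repr.injective (toLex.injective h)
  let : LinearOrder X := LinearOrder.lift' f hf
  have hadd : ∀ p q : X, f (p + q) = f p + f q := fun p q => by simp [f]
  have hlt : ∀ p q : X, p < q ↔ f p < f q := fun p q => Iff.rfl
  have hle : ∀ p q : X, p ≤ q ↔ f p ≤ f q := fun p q => Iff.rfl
  have : IsOrderedAddMonoid X :=
    { add_le_add_left := fun p q h r => by
        rw [hle, hadd, hadd]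
        exact add_le_add_left ((hle _ _).1 h) _ }
  refine ⟨inferInstance, this, isStrictOrderedModule_of_smul_lt_smul fun α p q hα hpq => ?_⟩
  -- Scaling by a positive scalar keeps the first coordinate at which two vectors differ, and the
  -- direction of the inequality there.
  obtain ⟨i, hi, hi'⟩ := Finsupp.Lex.lt_iff.1 ((hlt p q).1 hpq)
  refine (hlt _ _).2 (Finsupp.Lex.lt_iff.2 ⟨i, fun j hj => ?_, ?_⟩)
  · have h₁ : b.repr p j = b.repr q j := hi j hj
    change b.repr (α • p) j = b.repr (α • q) j
    rw [map_smul, map_smul, Finsupp.smul_apply, Finsupp.smul_apply, h₁]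
  · have h₁ : b.repr p i < b.repr q i := hi'
    change b.repr (α • p) i < b.repr (α • q) i
    rw [map_smul, map_smul, Finsupp.smul_apply, Finsupp.smul_apply]
    exact mul_lt_mul_of_pos_left h₁ hα

end OrderedVectorSpaces

/-! ### Terms as functions built from linear operations. -/

namespace DensePair

open ManySorted

section Elimination

variable {F : Type u}

/-- The functions on assignments given by terms. -/
def IsTermFun (U : Struct.{0, u, 0, w} (LPrec F)) {V : Type} (τ : V → Srt) (s : Srt)
    (f : ((i : V) → Car U (τ i)) → Car U s) : Prop :=
  ∃ t : Term (LPrec F) τ s, ∀ e, t.eval U e = f e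

variable {U : Struct.{0, u, 0, w} (LPrec F)} {V : Type} {τ : V → Srt}

theorem isTermFun_var (i : V) : IsTermFun U τ (τ i) (fun e => e i) := ⟨.var i, fun _ => rfl⟩

theorem funMap_add (v : Fin 2 → Car U Srt.home) :
    U.funMap Fn.add v = uadd U Srt.home (v 0) (v 1) :=
  congrArg (U.funMap Fn.add) (funext fun i : Fin 2 => by fin_cases i <;> rfl)

theorem funMap_qadd (v : Fin 2 → Car U Srt.quot) :
    U.funMap Fn.qadd v = uadd U Srt.quot (v 0) (v 1) :=
  congrArg (U.funMap Fn.qadd) (funext fun i : Fin 2 => by fin_cases i <;> rfl)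

theorem funMap_smul (α : F) (v : Fin 1 → Car U Srt.home) :
    U.funMap (Fn.smul α) v = usmul U α Srt.home (v 0) :=
  congrArg (U.funMap (Fn.smul α)) (funext fun i : Fin 1 => by fin_cases i; rfl)

theorem funMap_qsmul (α : F) (v : Fin 1 → Car U Srt.quot) :
    U.funMap (Fn.qsmul α) v = usmul U α Srt.quot (v 0) :=
  congrArg (U.funMap (Fn.qsmul α)) (funext fun i : Fin 1 => by fin_cases i; rfl)

theorem funMap_proj (v : Fin 1 → Car U Srt.home) : U.funMap Fn.proj v = uproj U (v 0) :=
  congrArg (U.funMap Fn.proj) (funext fun i : Fin 1 => by fin_cases i; rfl)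

theorem relMap_lt (v : Fin 2 → Car U Srt.home) :
    U.relMap (some Rl.lt) v ↔ ult U Srt.home (v 0) (v 1) :=
  iff_of_eq (congrArg (U.relMap (some Rl.lt)) (funext fun i : Fin 2 => by fin_cases i <;> rfl))

theorem relMap_prec (v : Fin 2 → Car U Srt.quot) :
    U.relMap none v ↔ ult U Srt.quot (v 0) (v 1) :=
  iff_of_eq (congrArg (U.relMap none) (funext fun i : Fin 2 => by fin_cases i <;> rfl))

theorem relMap_mem (v : Fin 1 → Car U Srt.home) :
    U.relMap (some Rl.mem) v ↔ umem U (v 0) :=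
  iff_of_eq (congrArg (U.relMap (some Rl.mem)) (funext fun i : Fin 1 => by fin_cases i; rfl))

/-- The symbols of `U` are the operations of the ordered vector spaces `Car U s` and of the linear
map `p`, all of whose fibres are dense. -/
structure Interprets [Field F] (U : Struct.{0, u, 0, w} (LPrec F))
    [∀ s, AddCommGroup (Car U s)] [∀ s, Module F (Car U s)] [∀ s, LinearOrder (Car U s)]
    (p : Car U Srt.home →ₗ[F] Car U Srt.quot) : Prop where
  zero (s : Srt) : uzero U s = 0
  add (s : Srt) (a b : Car U s) : uadd U s a b = a + b
  smul (α : F) (s : Srt) (a : Car U s) : usmul U α s a = α • a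
  proj (a : Car U Srt.home) : uproj U a = p a
  mem (a : Car U Srt.home) : umem U a ↔ p a = 0
  lt (s : Srt) (a b : Car U s) : ult U s a b ↔ a < b
  dense (a b : Car U Srt.home) (c : Car U Srt.quot) : a < b → ∃ d, a < d ∧ d < b ∧ p d = c

variable [Field F] [∀ s, AddCommGroup (Car U s)] [∀ s, Module F (Car U s)]
  [∀ s, LinearOrder (Car U s)]
  {p : Car U Srt.home →ₗ[F] Car U Srt.quot}

namespace Interprets

theorem isTermFun_zero (hU : Interprets U p) (s : Srt) : IsTermFun U τ s (fun _ => 0) :=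
  ⟨tzero s, fun e => (eval_tzero U e s).trans (hU.zero s)⟩

theorem isTermFun_add (hU : Interprets U p) {s : Srt} {f g : ((i : V) → Car U (τ i)) → Car U s}
    (hf : IsTermFun U τ s f) (hg : IsTermFun U τ s g) : IsTermFun U τ s (fun e => f e + g e) := by
  obtain ⟨t, ht⟩ := hf
  obtain ⟨t', ht'⟩ := hg
  exact ⟨tadd s t t', fun e => by rw [eval_tadd, hU.add, ht, ht']⟩

theorem isTermFun_smul (hU : Interprets U p)
    (α : F) {s : Srt} {f : ((i : V) → Car U (τ i)) → Car U s}
    (hf : IsTermFun U τ s f) : IsTermFun U τ s (fun e => α • f e) := by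
  obtain ⟨t, ht⟩ := hf
  exact ⟨tsmul α s t, fun e => by rw [eval_tsmul, hU.smul, ht]⟩

theorem isTermFun_proj (hU : Interprets U p) {f : ((i : V) → Car U (τ i)) → Car U Srt.home}
    (hf : IsTermFun U τ Srt.home f) : IsTermFun U τ Srt.quot (fun e => p (f e)) := by
  obtain ⟨t, ht⟩ := hf
  exact ⟨tproj t, fun e => by rw [eval_tproj, hU.proj, ht]⟩

theorem isTermFun_neg (hU : Interprets U p) {s : Srt} {f : ((i : V) → Car U (τ i)) → Car U s}
    (hf : IsTermFun U τ s f) : IsTermFun U τ s (fun e => -f e) := by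
  simpa using hU.isTermFun_smul (-1) hf

theorem isTermFun_sub (hU : Interprets U p) {s : Srt} {f g : ((i : V) → Car U (τ i)) → Car U s}
    (hf : IsTermFun U τ s f) (hg : IsTermFun U τ s g) : IsTermFun U τ s (fun e => f e - g e) := by
  simpa [sub_eq_add_neg] using hU.isTermFun_add hf (hU.isTermFun_neg hg)

/-- Induction on the functions that terms define rather than on syntax: addition and scaling are
treated uniformly in both sorts, and `0` and `1` are both covered by `const`. Its hypothesis ranges
over all contexts because later motives concern terms in a smaller context. -/
theorem term_induction (hU : Interprets U p)
    {motive : (s : Srt) → (((i : V) → Car U (τ i)) → Car U s) → Prop}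
    (var : ∀ i, motive (τ i) (fun e => e i))
    (const : ∀ c, (∀ {W : Type} (τ' : W → Srt), IsTermFun U τ' Srt.home (fun _ => c)) →
      motive Srt.home (fun _ => c))
    (add : ∀ s f g, motive s f → motive s g → motive s (fun e => f e + g e))
    (smul : ∀ s (α : F) f, motive s f → motive s (fun e => α • f e))
    (proj : ∀ f, motive Srt.home f → motive Srt.quot (fun e => p (f e))) :
    {s : Srt} → (t : Term (LPrec F) τ s) → motive s (fun e => t.eval U e)
  | _, .var i => var i
  | _, .app f ts => by
    have ih := fun i => term_induction hU var const add smul proj (ts i)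
    cases f with
    | zero =>
      have h := const 0 (fun _ => hU.isTermFun_zero _)
      refine Eq.mpr (congrArg (motive Srt.home) (funext fun e => ?_)) h
      exact (congrArg (U.funMap Fn.zero) (funext fun i : Fin 0 => i.elim0)).trans
        (hU.zero Srt.home)
    | one =>
      have h := const (U.funMap Fn.one (fun i : Fin 0 => i.elim0)) (fun τ' =>
        ⟨.app (L := LPrec F) Fn.one (fun i : Fin 0 => i.elim0), fun e =>
          congrArg (U.funMap Fn.one) (funext fun i : Fin 0 => i.elim0)⟩)
      refine Eq.mpr (congrArg (motive Srt.home) (funext fun e => ?_)) h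
      exact congrArg (U.funMap Fn.one) (funext fun i : Fin 0 => i.elim0)
    | add =>
      have h := add Srt.home _ _ (ih (0 : Fin 2)) (ih (1 : Fin 2))
      refine Eq.mpr (congrArg (motive Srt.home) (funext fun e => ?_)) h
      exact (funMap_add _).trans (hU.add _ _ _)
    | smul α =>
      have h := smul Srt.home α _ (ih (0 : Fin 1))
      refine Eq.mpr (congrArg (motive Srt.home) (funext fun e => ?_)) h
      exact (funMap_smul α _).trans (hU.smul _ _ _)
    | proj =>
      have h := proj _ (ih (0 : Fin 1))
      refine Eq.mpr (congrArg (motive Srt.quot) (funext fun e => ?_)) h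
      exact (funMap_proj _).trans (hU.proj _)
    | qadd =>
      have h := add Srt.quot _ _ (ih (0 : Fin 2)) (ih (1 : Fin 2))
      refine Eq.mpr (congrArg (motive Srt.quot) (funext fun e => ?_)) h
      exact (funMap_qadd _).trans (hU.add _ _ _)
    | qsmul α =>
      have h := smul Srt.quot α _ (ih (0 : Fin 1))
      refine Eq.mpr (congrArg (motive Srt.quot) (funext fun e => ?_)) h
      exact (funMap_qsmul α _).trans (hU.smul _ _ _)

end Interprets

end Elimination

end DensePair

/-! ### Quantifier elimination. -/

namespace DensePair

open ManySorted

section SignDetermined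

variable {F : Type u} {U : Struct.{0, u, 0, w} (LPrec F)} {V : Type} {τ : V → Srt}

/-- Extension of an assignment by a value for a new variable of the sort `s`. -/
def extendAssign {s : Srt} (e : (i : V) → Car U (τ i)) (a : Car U s) :
    (i : Option V) → Car U (extend τ s i) := U.extendVal e a

/-- The predicate `P` on assignments depends only on the signs of finitely many terms. -/
def SignDetermined (U : Struct.{0, u, 0, w} (LPrec F)) [∀ s, AddCommGroup (Car U s)]
    [∀ s, LinearOrder (Car U s)] {V : Type} (τ : V → Srt)
    (P : ((i : V) → Car U (τ i)) → Prop) : Prop :=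
  ∃ A : (s : Srt) → Set (((i : V) → Car U (τ i)) → Car U s),
    (∀ s, (A s).Finite) ∧ (∀ s, ∀ f ∈ A s, IsTermFun U τ s f) ∧
      ∀ e e', (∀ s, ∀ f ∈ A s, SignType.sign (f e) = SignType.sign (f e')) → (P e ↔ P e')

variable [∀ s, AddCommGroup (Car U s)]

/-- The effect of a variable of the sort `s` on terms of the sort `s'`. -/
def link [Field F] [∀ s, Module F (Car U s)] (p : Car U Srt.home →ₗ[F] Car U Srt.quot) :
    (s s' : Srt) → Car U s →ₗ[F] Car U s'
  | .home, .home => LinearMap.id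
  | .home, .quot => p
  -- No function symbol leads from the quotient sort to the home sort.
  | .quot, .home => 0
  | .quot, .quot => LinearMap.id

theorem link_self [Field F] [∀ s, Module F (Car U s)]
    (p : Car U Srt.home →ₗ[F] Car U Srt.quot) (s : Srt) (a : Car U s) : link p s s a = a := by
  cases s <;> rfl

variable [∀ s, LinearOrder (Car U s)]

theorem signDetermined_of_sign {s : Srt} {f : ((i : V) → Car U (τ i)) → Car U s}
    (hf : IsTermFun U τ s f) (R : SignType → Prop) :
    SignDetermined U τ (fun e => R (SignType.sign (f e))) := by
  -- The family is `{f}` at the sort `s` and empty at the other sort.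
  refine ⟨fun s' => {g | ∃ h : s = s', h ▸ f = g}, fun s' => ?_, ?_, fun e e' h => ?_⟩
  · refine Set.Subsingleton.finite ?_
    rintro _ ⟨h, rfl⟩ _ ⟨_, rfl⟩
    rfl
  · rintro s' _ ⟨rfl, rfl⟩
    exact hf
  · exact iff_of_eq (congrArg R (h s f ⟨rfl, rfl⟩))

theorem SignDetermined.congr {P P' : ((i : V) → Car U (τ i)) → Prop}
    (h : SignDetermined U τ P) (hP : ∀ e, P' e ↔ P e) : SignDetermined U τ P' := by
  rwa [show P' = P from funext fun e => propext (hP e)]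

theorem signDetermined_const (c : Prop) : SignDetermined U τ (fun _ => c) :=
  ⟨fun _ => ∅, fun _ => Set.finite_empty, fun _ _ h => h.elim, fun _ _ _ => Iff.rfl⟩

theorem SignDetermined.imp {P P' : ((i : V) → Car U (τ i)) → Prop}
    (h : SignDetermined U τ P) (h' : SignDetermined U τ P') :
    SignDetermined U τ (fun e => P e → P' e) := by
  obtain ⟨A, hA, hA', H⟩ := h
  obtain ⟨A₁, hA₁, hA₁', H'⟩ := h'
  refine ⟨fun s => A s ∪ A₁ s, fun s => (hA s).union (hA₁ s), fun s f hf =>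
    hf.elim (hA' s f) (hA₁' s f), fun e e' h => imp_congr ?_ ?_⟩
  · exact H e e' fun s f hf => h s f (Or.inl hf)
  · exact H' e e' fun s f hf => h s f (Or.inr hf)

variable [Field F] [∀ s, Module F (Car U s)] {p : Car U Srt.home →ₗ[F] Car U Srt.quot}

namespace Interprets

/-- All operations are linear, so a term is affine in any one of its variables, with a scalar
coefficient from `F`. This makes the sign of a term a condition on the position of the variable, or
of its image, relative to one threshold. -/
theorem term_extend (hU : Interprets U p)
    (s : Srt) {s' : Srt} (t : Term (LPrec F) (extend τ s) s') :
    ∃ (f : ((i : V) → Car U (τ i)) → Car U s') (α : F), IsTermFun U τ s' f ∧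
      ∀ e a, t.eval U (extendAssign e a) = f e + α • link p s s' a := by
  refine hU.term_induction (τ := extend τ s) (motive := fun s' g =>
    ∃ (f : ((i : V) → Car U (τ i)) → Car U s') (α : F), IsTermFun U τ s' f ∧
      ∀ e a, g (extendAssign e a) = f e + α • link p s s' a) ?_ ?_ ?_ ?_ ?_ t
  · rintro (_ | i)
    · refine ⟨fun _ => 0, 1, hU.isTermFun_zero _, fun e a => ?_⟩
      rw [one_smul, zero_add]
      exact (link_self p s a).symm
    · refine ⟨fun e => e i, 0, isTermFun_var i, fun e a => ?_⟩
      exact (by rw [zero_smul, add_zero] : e i = e i + (0 : F) • link p s (τ i) a)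
  · intro c hc
    exact ⟨fun _ => c, 0, hc τ, fun e a => by rw [zero_smul, add_zero]⟩
  · rintro s' g g' ⟨f, α, hf, h⟩ ⟨f', α', hf', h'⟩
    refine ⟨_, α + α', hU.isTermFun_add hf hf', fun e a => ?_⟩
    change g _ + g' _ = f e + f' e + _
    rw [h, h', add_smul]
    abel
  · rintro s' β g ⟨f, α, hf, h⟩
    exact ⟨_, β * α, hU.isTermFun_smul β hf, fun e a =>
      (congrArg (β • ·) (h e a)).trans (by rw [smul_add, mul_smul])⟩
  · rintro g ⟨f, α, hf, h⟩
    cases s with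
    | home =>
      exact ⟨_, α, hU.isTermFun_proj hf, fun e a =>
        (congrArg p (h e a)).trans (by rw [map_add, map_smul]; rfl)⟩
    | quot =>
      -- The home term ignores the quotient variable, so `α` multiplied zero. After projection the
      -- link is the identity, and the coefficient must be reset to `0`.
      refine ⟨_, 0, hU.isTermFun_proj hf, fun e a => ?_⟩
      refine (congrArg p (h e a)).trans ?_
      rw [zero_smul, add_zero, map_add, map_smul]
      change p (f e) + α • p 0 = p (f e)
      rw [map_zero, smul_zero, add_zero]

theorem signDetermined_equal (hU : Interprets U p) {s : Srt} (t₁ t₂ : Term (LPrec F) τ s) :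
    SignDetermined U τ (fun e => t₁.eval U e = t₂.eval U e) := by
  have h := signDetermined_of_sign (hU.isTermFun_sub (f := fun e => t₁.eval U e)
    (g := fun e => t₂.eval U e) ⟨t₁, fun _ => rfl⟩ ⟨t₂, fun _ => rfl⟩) (fun σ => σ = 0)
  exact h.congr fun e => by rw [sign_eq_zero_iff, sub_eq_zero]

/-- Comparisons are signs of differences, and membership in `Q` is the vanishing of the projection,
so `Q` contributes only a quotient term. -/
theorem signDetermined_rel (hU : Interprets U p)
    [∀ s, IsOrderedAddMonoid (Car U s)] (r : (LPrec F).Rel)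
    (ts : (i : Fin ((LPrec F).relArity r)) → Term (LPrec F) τ ((LPrec F).relDom r i)) :
    SignDetermined U τ (fun e => U.relMap r (fun i => (ts i).eval U e)) := by
  have hlt : ∀ (s : Srt) (t₁ t₂ : Term (LPrec F) τ s),
      SignDetermined U τ (fun e => ult U s (t₁.eval U e) (t₂.eval U e)) := fun s t₁ t₂ => by
    have h := signDetermined_of_sign (hU.isTermFun_sub (f := fun e => t₁.eval U e)
      (g := fun e => t₂.eval U e) ⟨t₁, fun _ => rfl⟩ ⟨t₂, fun _ => rfl⟩) (fun σ => σ = -1)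
    exact h.congr fun e => by rw [sign_eq_neg_one_iff, sub_neg, hU.lt]
  rcases r with _ | (_ | _)
  · have h := hlt .quot (ts (0 : Fin 2)) (ts (1 : Fin 2))
    exact h.congr fun e => relMap_prec _
  · have h := hlt .home (ts (0 : Fin 2)) (ts (1 : Fin 2))
    exact h.congr fun e => relMap_lt _
  · have h := signDetermined_of_sign (hU.isTermFun_proj (f := fun e => (ts (0 : Fin 1)).eval U e)
      ⟨ts (0 : Fin 1), fun _ => rfl⟩) (fun σ => σ = 0)
    exact h.congr fun e => (relMap_mem _).trans ((hU.mem _).trans sign_eq_zero_iff.symm)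

variable [LinearOrder F] [IsStrictOrderedRing F] [∀ s, IsOrderedAddMonoid (Car U s)]
  [∀ s, IsStrictOrderedModule F (Car U s)] [∀ s, Nontrivial (Car U s)]

/-- The extension property: a point can be moved along with finitely many affine functions whose
relevant sign conditions agree. -/
theorem exists_same_signs (hU : Interprets U p) (s : Srt) {ι : Srt → Type*} [∀ s', Finite (ι s')]
    (f f' : (s' : Srt) → ι s' → Car U s') (α : (s' : Srt) → ι s' → F)
    (h₁ : ∀ s' i, SignType.sign (f s' i) = SignType.sign (f' s' i))
    (h₂ : ∀ s' i j, SignType.sign (-((α s' i)⁻¹ • f s' i) - -((α s' j)⁻¹ • f s' j)) =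
      SignType.sign (-((α s' i)⁻¹ • f' s' i) - -((α s' j)⁻¹ • f' s' j)))
    (h₃ : ∀ i j, SignType.sign (f .quot j + α .quot j • p (-((α .home i)⁻¹ • f .home i))) =
      SignType.sign (f' .quot j + α .quot j • p (-((α .home i)⁻¹ • f' .home i))))
    (a : Car U s) : ∃ a' : Car U s, ∀ s' i,
      SignType.sign (f s' i + α s' i • link p s s' a) =
        SignType.sign (f' s' i + α s' i • link p s s' a') := by
  -- The quotient conditions alone can always be matched, since their thresholds have the same order
  -- type on both sides.
  have hK : ∀ c : Car U Srt.quot, ∃ c', ∀ j, SignType.sign (f .quot j + α .quot j • c) =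
      SignType.sign (f' .quot j + α .quot j • c') := fun c => by
    obtain ⟨c', hc'⟩ := exists_sign_sub_eq F _ _ (h₂ .quot) c
    exact ⟨c', fun j => sign_add_smul_congr (h₁ _ j) (hc' j)⟩
  cases s with
  | quot =>
    obtain ⟨a', ha'⟩ := hK a
    refine ⟨a', fun s' i => ?_⟩
    cases s' with
    | quot => exact ha' i
    | home => simpa [link] using h₁ _ i
  | home =>
    rcases exists_cut F _ _ (h₂ .home) a with ⟨i, rfl⟩ | ⟨m₁, m₂, hm, H⟩
    -- At a threshold the new point is forced, and so is its image; `h₃` is the hypothesis that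
    -- compares the images.
    · refine ⟨-((α .home i)⁻¹ • f' .home i), fun s' j => ?_⟩
      cases s' with
      | home => exact sign_add_smul_congr (h₁ _ j) (h₂ .home i j)
      | quot => exact h₃ i j
    · obtain ⟨c', hc'⟩ := hK (p a)
      -- Off the thresholds the home conditions leave an open interval, which meets the fibre over
      -- the required `c'`.
      obtain ⟨a', ha₁, ha₂, ha'⟩ := hU.dense m₁ m₂ c' hm
      refine ⟨a', fun s' j => ?_⟩
      cases s' with
      | home => exact sign_add_smul_congr (h₁ _ j) (H a' ha₁ ha₂ j)
      | quot =>
        rw [← ha'] at hc'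
        exact hc' j

/-- The new terms are those whose signs decide which sign patterns a witness can realize: the
constant parts, the differences of thresholds within each sort, and the quotient terms evaluated at
the projected home thresholds. -/
theorem signDetermined_all (hU : Interprets U p)
    (s : Srt) {P : ((i : Option V) → Car U (extend τ s i)) → Prop}
    (hP : SignDetermined U (extend τ s) P) :
    SignDetermined U τ (fun e => ∀ a : Car U s, P (extendAssign e a)) := by
  obtain ⟨A, hA, hA', H⟩ := hP
  have hfin : ∀ s', Finite (A s') := fun s' => (hA s').to_subtype
  have hdec : ∀ s' (g : A s'), ∃ (f : ((i : V) → Car U (τ i)) → Car U s') (α : F),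
      IsTermFun U τ s' f ∧ ∀ e a, g.1 (extendAssign e a) = f e + α • link p s s' a := by
    rintro s' ⟨g, hg⟩
    obtain ⟨t, ht⟩ := hA' s' g hg
    obtain ⟨f, α, hf, h⟩ := hU.term_extend s t
    exact ⟨f, α, hf, fun e a => (ht _).symm.trans (h e a)⟩
  choose f α hf hfe using hdec
  let z (s' : Srt) (i : A s') (e : (i : V) → Car U (τ i)) : Car U s' := -((α s' i)⁻¹ • f s' i e)
  have hz : ∀ s' i, IsTermFun U τ s' (z s' i) := fun s' i =>
    hU.isTermFun_neg (hU.isTermFun_smul _ (hf s' i))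
  -- These mixed terms record the quotient signs that result when a home witness coincides with a
  -- home threshold.
  let C : (s' : Srt) → Set (((i : V) → Car U (τ i)) → Car U s')
    | .home => ∅
    | .quot => Set.range fun q : A .home × A .quot =>
        fun e => f .quot q.2 e + α .quot q.2 • p (z .home q.1 e)
  refine ⟨fun s' => Set.range (f s') ∪
    (Set.range fun q : A s' × A s' => fun e => z s' q.1 e - z s' q.2 e) ∪ C s',
    fun s' => ?_, fun s' g hg => ?_, fun e e' h => ?_⟩
  · refine ((Set.finite_range _).union (Set.finite_range _)).union ?_
    cases s' with
    | home => exact Set.finite_empty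
    | quot => exact Set.finite_range _
  · rcases hg with (⟨i, rfl⟩ | ⟨q, rfl⟩) | hg
    · exact hf s' i
    · exact hU.isTermFun_sub (hz _ _) (hz _ _)
    · cases s' with
      | home => exact hg.elim
      | quot =>
        obtain ⟨q, rfl⟩ := hg
        exact hU.isTermFun_add (hf _ _) (hU.isTermFun_smul _ (hU.isTermFun_proj (hz _ _)))
  · have h₁ : ∀ s' i, SignType.sign (f s' i e) = SignType.sign (f s' i e') := fun s' i =>
      h s' _ (Or.inl (Or.inl ⟨i, rfl⟩))
    have h₂ : ∀ s' i j, SignType.sign (z s' i e - z s' j e) =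
        SignType.sign (z s' i e' - z s' j e') := fun s' i j =>
      h s' _ (Or.inl (Or.inr ⟨(i, j), rfl⟩))
    have h₃ : ∀ i j, SignType.sign (f .quot j e + α .quot j • p (z .home i e)) =
        SignType.sign (f .quot j e' + α .quot j • p (z .home i e')) := fun i j =>
      h .quot _ (Or.inr ⟨(i, j), rfl⟩)
    constructor
    · intro hall a'
      obtain ⟨a, ha⟩ := hU.exists_same_signs s (fun s' i => f s' i e') (fun s' i => f s' i e) α
        (fun s' i => (h₁ s' i).symm) (fun s' i j => (h₂ s' i j).symm)
        (fun i j => (h₃ i j).symm) a'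
      refine (H _ _ fun s' g hg => ?_).1 (hall a)
      have := (ha s' ⟨g, hg⟩).symm
      rwa [← hfe, ← hfe] at this
    · intro hall a'
      obtain ⟨a, ha⟩ := hU.exists_same_signs s (fun s' i => f s' i e) (fun s' i => f s' i e') α
        h₁ h₂ h₃ a'
      refine (H _ _ fun s' g hg => ?_).2 (hall a)
      have := ha s' ⟨g, hg⟩
      rwa [← hfe, ← hfe] at this

/-- Quantifier elimination: every formula depends only on the signs of finitely many terms. -/
theorem signDetermined_realize (hU : Interprets U p)
    : {V : Type} → {τ : V → Srt} → (φ : Formula (LPrec F) τ) →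
    SignDetermined U τ (fun e => φ.Realize U e)
  | _, _, .falsum => signDetermined_const False
  | _, _, .equal t₁ t₂ => hU.signDetermined_equal t₁ t₂
  | _, _, .rel r ts => hU.signDetermined_rel r ts
  | _, _, .imp φ ψ => (signDetermined_realize hU φ).imp (signDetermined_realize hU ψ)
  | _, _, .all s φ => hU.signDetermined_all s (signDetermined_realize hU φ)

end Interprets

end SignDetermined

end DensePair

/-! ### Moving one index of an increasing tuple. -/

section Tuples

theorem exists_lt_forall_finset_lt {I : Type*} [LinearOrder I] {c : I} (hne : ∃ j, j < c)
    (hlim : ∀ j < c, ∃ k, j < k ∧ k < c) (S : Finset I) (hS : ∀ j ∈ S, j < c) :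
    ∃ k < c, ∀ j ∈ S, j < k := by
  classical
  induction S using Finset.induction_on with
  | empty => exact hne.imp fun j hj => ⟨hj, by simp⟩
  | insert i S _ ih =>
    obtain ⟨k, hk, hkS⟩ := ih fun j hj => hS j (Finset.mem_insert_of_mem hj)
    obtain ⟨l, hl, hlc⟩ := hlim (max i k) (max_lt (hS i (Finset.mem_insert_self _ _)) hk)
    refine ⟨l, hlc, fun j hj => ?_⟩
    rcases Finset.mem_insert.1 hj with rfl | hj
    · exact (le_max_left _ _).trans_lt hl
    · exact ((hkS j hj).trans_le (le_max_right _ _)).trans hl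

/-- If the order type of the values of `h` at increasing tuples is constant and `c` is a limit from
both sides, then each value of `h` lies between two values at tuples that avoid `c`. -/
theorem exists_tuples_avoiding {I : Type*} [LinearOrder I] {X : Type*} [LinearOrder X] {c : I}
    (hlo : ∃ j, j < c) (hlo' : ∀ j < c, ∃ k, j < k ∧ k < c)
    (hhi : ∃ j, c < j) (hhi' : ∀ j, c < j → ∃ k, c < k ∧ k < j) {n : ℕ} (h : (Fin n → I) → X)
    (hh : ∀ (κ κ' : Fin n → Fin (n + 1)) (j j' : Fin (n + 1) → I), StrictMono j → StrictMono j' →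
      (h (j ∘ κ) < h (j ∘ κ') ↔ h (j' ∘ κ) < h (j' ∘ κ')))
    (i : Fin n → I) (hi : StrictMono i) :
    ∃ i₁ i₂ : Fin n → I, StrictMono i₁ ∧ StrictMono i₂ ∧ (∀ q, i₁ q ≠ c) ∧ (∀ q, i₂ q ≠ c) ∧
      (h i₁ ≤ h i ∧ h i ≤ h i₂ ∨ h i₂ ≤ h i ∧ h i ≤ h i₁) := by
  classical
  by_cases hc : ∃ q, i q = c
  swap
  · push Not at hc
    exact ⟨i, i, hi, hi, hc, hc, Or.inl ⟨le_rfl, le_rfl⟩⟩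
  obtain ⟨q, rfl⟩ := hc
  obtain ⟨k, hk, hk'⟩ := exists_lt_forall_finset_lt hlo hlo'
    ((Finset.univ.filter fun r => r < q).image i) (by simpa using fun r hr => hi hr)
  obtain ⟨l, hl, hl'⟩ := exists_lt_forall_finset_lt (I := Iᵒᵈ) (c := OrderDual.toDual (i q))
    (by obtain ⟨j, hj⟩ := hhi; exact ⟨OrderDual.toDual j, hj⟩)
    (fun j hj => by
      obtain ⟨m, hm, hm'⟩ := hhi' (OrderDual.ofDual j) hj
      exact ⟨OrderDual.toDual m, hm', hm⟩)
    ((Finset.univ.filter fun r => q < r).image i) (by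
      intro j hj
      obtain ⟨r, hr, rfl⟩ := Finset.mem_image.1 hj
      exact hi (Finset.mem_filter.1 hr).2)
  have hkm : ∀ r < q, i r < k := fun r hr => hk' _ (Finset.mem_image_of_mem _ (by simpa using hr))
  have hlm : ∀ r, q < r → OrderDual.ofDual l < i r := fun r hr =>
    hl' _ (Finset.mem_image_of_mem _ (by simpa using hr))
  have hl : i q < OrderDual.ofDual l := hl
  generalize OrderDual.ofDual l = l at hl hlm
  -- `j₁` contains `k` just before `c`, and `j₂` contains `l` just after it. Omitting position `q`
  -- gives `i` from `j₁` and the tuple with `c` replaced by `l` from `j₂`; omitting position `q + 1`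
  -- gives the tuple with `c` replaced by `k` from `j₁` and `i` from `j₂`.
  let j₁ : Fin (n + 1) → I := q.castSucc.insertNth k i
  let j₂ : Fin (n + 1) → I := q.succ.insertNth l i
  have hj₁ : StrictMono j₁ := (Fin.strictMono_insertNth_iff _ _ _).2
    ⟨hi, fun r hr => hkm r (Fin.castSucc_lt_castSucc_iff.1 hr),
      fun r hr => hk.trans_le (hi.monotone (Fin.castSucc_le_castSucc_iff.1 hr))⟩
  have hj₂ : StrictMono j₂ := (Fin.strictMono_insertNth_iff _ _ _).2
    ⟨hi, fun r hr => (hi.monotone (Fin.castSucc_lt_succ_iff.1 hr)).trans_lt hl,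
      fun r hr => hlm r (Fin.succ_le_castSucc_iff.1 hr)⟩
  have e₁ : j₁ ∘ q.castSucc.succAbove = i := Fin.insertNth_comp_succAbove _ _ _
  have e₂ : j₂ ∘ q.succ.succAbove = i := Fin.insertNth_comp_succAbove _ _ _
  have hc₁ : j₁ q.succ = i q := by
    rw [← Fin.succAbove_castSucc_self]; exact congrFun e₁ q
  have hc₂ : j₂ q.castSucc = i q := by
    rw [← Fin.succAbove_succ_self]; exact congrFun e₂ q
  refine ⟨j₁ ∘ q.succ.succAbove, j₂ ∘ q.castSucc.succAbove,
    hj₁.comp (Fin.strictMono_succAbove _), hj₂.comp (Fin.strictMono_succAbove _),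
    fun r hr => Fin.succAbove_ne _ _ (hj₁.injective (hr.trans hc₁.symm)),
    fun r hr => Fin.succAbove_ne _ _ (hj₂.injective (hr.trans hc₂.symm)), ?_⟩
  -- Hence replacing `k` by `c` and replacing `c` by `l` change `h` in the same direction.
  have h₁ := hh q.succ.succAbove q.castSucc.succAbove j₁ j₂ hj₁ hj₂
  have h₂ := hh q.castSucc.succAbove q.succ.succAbove j₁ j₂ hj₁ hj₂
  rw [e₁, e₂] at h₁ h₂
  rcases lt_trichotomy (h (j₁ ∘ q.succ.succAbove)) (h i) with H | H | H
  · exact Or.inl ⟨H.le, (h₁.1 H).le⟩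
  · exact Or.inl ⟨H.le, not_lt.1 fun H' => H.not_gt (h₂.2 H')⟩
  · exact Or.inr ⟨(h₂.1 H).le, H.le⟩

end Tuples

/-! ### The index order with a point added. -/

namespace ManySorted

variable {I₁ : Type y} {I₂ : Type z}

/-- The added element of `I₁ + (c) + I₂`. -/
def mid : I₁ ⊕ₗ (Unit ⊕ₗ I₂) := Sum.inrₗ (Sum.inlₗ ())

theorem exists_skip_eq {j : I₁ ⊕ₗ (Unit ⊕ₗ I₂)} (hj : j ≠ mid) : ∃ k, skip k = j := by
  induction j using Lex.rec with | _ j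
  rcases j with j | j
  · exact ⟨Sum.inlₗ j, rfl⟩
  · induction j using Lex.rec with | _ j
    rcases j with j | j
    · exact (hj rfl).elim
    · exact ⟨Sum.inrₗ j, rfl⟩

variable [LinearOrder I₁] [LinearOrder I₂]

theorem strictMono_skip : StrictMono (skip : I₁ ⊕ₗ I₂ → I₁ ⊕ₗ (Unit ⊕ₗ I₂)) := by
  intro j k h
  induction j using Lex.rec with | _ j
  induction k using Lex.rec with | _ k
  rcases j with j | j <;> rcases k with k | k
  · exact Sum.Lex.inl_lt_inl_iff.2 (Sum.Lex.inl_lt_inl_iff.1 h)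
  · exact Sum.Lex.inl_lt_inr _ _
  · exact (Sum.Lex.not_inr_lt_inl h).elim
  · exact Sum.Lex.inr_lt_inr_iff.2 (Sum.Lex.inr_lt_inr_iff.2 (Sum.Lex.inr_lt_inr_iff.1 h))

theorem exists_strictMono_skip_comp_eq {n : ℕ} {i : Fin n → I₁ ⊕ₗ (Unit ⊕ₗ I₂)}
    (hi : StrictMono i) (hc : ∀ q, i q ≠ mid) :
    ∃ i₀ : Fin n → I₁ ⊕ₗ I₂, StrictMono i₀ ∧ skip ∘ i₀ = i := by
  choose i₀ h using fun q => exists_skip_eq (hc q)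
  exact ⟨i₀, fun q r hqr => strictMono_skip.lt_iff_lt.1 (by rw [h, h]; exact hi hqr), funext h⟩

theorem exists_lt_mid [Nonempty I₁] : ∃ j : I₁ ⊕ₗ (Unit ⊕ₗ I₂), j < mid :=
  ⟨Sum.inlₗ (Classical.arbitrary I₁), Sum.Lex.inl_lt_inr _ _⟩

theorem exists_mid_lt [Nonempty I₂] : ∃ j : I₁ ⊕ₗ (Unit ⊕ₗ I₂), mid < j :=
  ⟨Sum.inrₗ (Sum.inrₗ (Classical.arbitrary I₂)),
    Sum.Lex.inr_lt_inr_iff.2 (Sum.Lex.inl_lt_inr _ _)⟩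

theorem exists_between_mid_left [NoMaxOrder I₁] (j : I₁ ⊕ₗ (Unit ⊕ₗ I₂)) (hj : j < mid) :
    ∃ k, j < k ∧ k < mid := by
  induction j using Lex.rec with | _ j
  rcases j with j | j
  · obtain ⟨k, hk⟩ := exists_gt j
    exact ⟨Sum.inlₗ k, Sum.Lex.inl_lt_inl_iff.2 hk, Sum.Lex.inl_lt_inr _ _⟩
  · induction j using Lex.rec with | _ j
    have hj := Sum.Lex.inr_lt_inr_iff.1 hj
    rcases j with j | j
    · exact (lt_irrefl _ hj).elim
    · exact (Sum.Lex.not_inr_lt_inl hj).elim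

theorem exists_between_mid_right [NoMinOrder I₂] (j : I₁ ⊕ₗ (Unit ⊕ₗ I₂)) (hj : mid < j) :
    ∃ k, mid < k ∧ k < j := by
  induction j using Lex.rec with | _ j
  rcases j with j | j
  · exact (Sum.Lex.not_inr_lt_inl hj).elim
  · induction j using Lex.rec with | _ j
    have hj := Sum.Lex.inr_lt_inr_iff.1 hj
    rcases j with j | j
    · exact (lt_irrefl _ hj).elim
    · obtain ⟨k, hk⟩ := exists_lt j
      exact ⟨Sum.inrₗ (Sum.inrₗ k), Sum.Lex.inr_lt_inr_iff.2 (Sum.Lex.inl_lt_inr _ _),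
        Sum.Lex.inr_lt_inr_iff.2 (Sum.Lex.inr_lt_inr_iff.2 hk)⟩

end ManySorted

/-! ### Distality by squeezing signs. -/

namespace DensePair

open ManySorted

section Distal

variable {F : Type u} [Field F] {U : Struct.{0, u, 0, w} (LPrec F)}
  [∀ s, AddCommGroup (Car U s)] [∀ s, LinearOrder (Car U s)] [∀ s, Module F (Car U s)]
  {p : Car U Srt.home →ₗ[F] Car U Srt.quot}

namespace Interprets

/-- Linearity separates the two groups of variables, constants going to the first summand. Only that
summand has to come from a term: the second will be evaluated at fixed parameters and acts as a
translation. -/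
theorem term_split (hU : Interprets U p) {V W : Type} {τ : V → Srt} {τ' : W → Srt} {s : Srt}
    (t : Term (LPrec F) (Sum.elim τ τ') s) :
    ∃ (f : ((i : V) → Car U (τ i)) → Car U s) (g : ((i : W) → Car U (τ' i)) → Car U s),
      IsTermFun U τ s f ∧ ∀ e, t.eval U e = f (fun i => e (.inl i)) + g (fun i => e (.inr i)) := by
  refine hU.term_induction (τ := Sum.elim τ τ') (motive := fun s h =>
    ∃ (f : ((i : V) → Car U (τ i)) → Car U s) (g : ((i : W) → Car U (τ' i)) → Car U s),
      IsTermFun U τ s f ∧ ∀ e, h e = f (fun i => e (.inl i)) + g (fun i => e (.inr i)))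
      ?_ ?_ ?_ ?_ ?_ t
  · rintro (i | i)
    · exact ⟨fun e => e i, fun _ => 0, isTermFun_var i, fun e => (add_zero _).symm⟩
    · exact ⟨fun _ => 0, fun e => e i, hU.isTermFun_zero _, fun e => (zero_add _).symm⟩
  · intro c hc
    exact ⟨fun _ => c, fun _ => 0, hc τ, fun e => (add_zero _).symm⟩
  · rintro s h h' ⟨f, g, hf, H⟩ ⟨f', g', hf', H'⟩
    exact ⟨_, fun e => g e + g' e, hU.isTermFun_add hf hf', fun e =>
      (congrArg₂ (· + ·) (H e) (H' e)).trans (add_add_add_comm _ _ _ _)⟩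
  · rintro s α h ⟨f, g, hf, H⟩
    exact ⟨_, fun e => α • g e, hU.isTermFun_smul α hf, fun e =>
      (congrArg (α • ·) (H e)).trans (smul_add _ _ _)⟩
  · rintro h ⟨f, g, hf, H⟩
    exact ⟨_, fun e => p (g e), hU.isTermFun_proj hf, fun e =>
      (congrArg p (H e)).trans (map_add _ _ _)⟩

variable {I : Type*} [LinearOrder I] {m : ℕ} {σ : Fin m → Srt}

/-- The order type of the values of a term along an indiscernible sequence is constant. -/
theorem lt_iff_lt_of_indiscernible (hU : Interprets U p)
    {a : I → (j : Fin m) → Car U (σ j)} (ha : U.Indiscernible a)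
    {n N : ℕ} {s : Srt} {f : ((q : Fin n × Fin m) → Car U (σ q.2)) → Car U s}
    (hf : IsTermFun U (fun q : Fin n × Fin m => σ q.2) s f) (κ κ' : Fin n → Fin N)
    (j j' : Fin N → I) (hj : StrictMono j) (hj' : StrictMono j') :
    f (fun q => a (j (κ q.1)) q.2) < f (fun q => a (j (κ' q.1)) q.2) ↔
      f (fun q => a (j' (κ q.1)) q.2) < f (fun q => a (j' (κ' q.1)) q.2) := by
  obtain ⟨t, ht⟩ := hf
  let τ : (Fin N × Fin m) ⊕ Fin 0 → Srt := Sum.elim (fun q : Fin N × Fin m => σ q.2) Fin.elim0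
  -- The blocks of `t` are sent to blocks among `N` common ones, so that the values for `κ` and `κ'`
  -- can be compared by a single formula.
  let r (κ : Fin n → Fin N) : Term (LPrec F) τ s :=
    t.subst (L := LPrec F) (fun q : Fin n × Fin m =>
      Term.var (L := LPrec F) (τ := τ) (Sum.inl (κ q.1, q.2)))
  have hr : ∀ (κ : Fin n → Fin N) (j : Fin N → I),
      (r κ).eval U (U.blockVal a (fun j : Fin 0 => j.elim0) j) =
        f (fun q => a (j (κ q.1)) q.2) := fun κ j =>
    (Term.eval_subst U _ _ t).trans (ht _)
  have H := ha N (flt s (r κ) (r κ')) j j' hj hj'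
  have key : ∀ j, (flt s (r κ) (r κ')).Realize U (U.blockVal a (fun j : Fin 0 => j.elim0) j) ↔
      f (fun q => a (j (κ q.1)) q.2) < f (fun q => a (j (κ' q.1)) q.2) := fun j => by
    refine (realize_flt U _ s _ _).trans ((hU.lt s _ _).trans ?_)
    exact iff_of_eq (congrArg₂ (· < ·) (hr κ j) (hr κ' j))
  exact (key j).symm.trans (H.trans (key j'))

/-- The sign of a term along a sequence indiscernible over parameters is constant. -/
theorem sign_eq_of_indiscernibleOver (hU : Interprets U p)
    {a : I → (j : Fin m) → Car U (σ j)} {k : ℕ}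
    {ρ : Fin k → Srt} {b : (j : Fin k) → Car U (ρ j)} (hab : U.IndiscernibleOver a b)
    {n : ℕ} {s : Srt} (t : Term (LPrec F) (Sum.elim (fun q : Fin n × Fin m => σ q.2) ρ) s)
    (i i' : Fin n → I) (hi : StrictMono i) (hi' : StrictMono i') :
    SignType.sign (t.eval U (U.blockVal a b i) : Car U s) =
      SignType.sign (t.eval U (U.blockVal a b i') : Car U s) := by
  have hlt : ∀ t₁ t₂ : Term (LPrec F) (Sum.elim (fun q : Fin n × Fin m => σ q.2) ρ) s,
      (t₁.eval U (U.blockVal a b i) : Car U s) < t₂.eval U (U.blockVal a b i) ↔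
        (t₁.eval U (U.blockVal a b i') : Car U s) < t₂.eval U (U.blockVal a b i') := by
    intro t₁ t₂
    have key : ∀ i, (flt s t₁ t₂).Realize U (U.blockVal a b i) ↔
        (t₁.eval U (U.blockVal a b i) : Car U s) < t₂.eval U (U.blockVal a b i) := fun i =>
      (realize_flt U _ s _ _).trans (hU.lt s _ _)
    exact (key i).symm.trans ((hab n (flt s t₁ t₂) i i' hi hi').trans (key i'))
  have hz : ∀ i : Fin n → I, (tzero s : Term (LPrec F)
      (Sum.elim (fun q : Fin n × Fin m => σ q.2) ρ) s).eval U (U.blockVal a b i) =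
        (0 : Car U s) := fun i => (eval_tzero U _ s).trans (hU.zero s)
  have h₁ := hlt t (tzero s)
  have h₂ := hlt (tzero s) t
  rw [hz, hz] at h₁ h₂
  generalize (t.eval U (U.blockVal a b i) : Car U s) = v at h₁ h₂ ⊢
  generalize (t.eval U (U.blockVal a b i') : Car U s) = v' at h₁ h₂ ⊢
  simp only [sign_apply, h₁, h₂]

variable [LinearOrder F] [IsStrictOrderedRing F] [∀ s, IsOrderedAddMonoid (Car U s)]
  [∀ s, IsStrictOrderedModule F (Car U s)] [∀ s, Nontrivial (Car U s)]

/-- By quantifier elimination it suffices to treat the sign of one term. Any tuple can be exchanged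
for one avoiding `c` without changing that sign, and among tuples avoiding `c` the sign is constant
by hypothesis. -/
theorem indiscernibleOver_of_skip (hU : Interprets U p)
    {I₁ : Type y} {I₂ : Type z} [LinearOrder I₁] [LinearOrder I₂]
    [Nonempty I₁] [NoMaxOrder I₁] [Nonempty I₂] [NoMinOrder I₂]
    {a : I₁ ⊕ₗ (Unit ⊕ₗ I₂) → (j : Fin m) → Car U (σ j)} (ha : U.Indiscernible a) {k : ℕ}
    {ρ : Fin k → Srt} {b : (j : Fin k) → Car U (ρ j)}
    (hab : U.IndiscernibleOver (a ∘ skip) b) : U.IndiscernibleOver a b := by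
  intro n φ i i' hi hi'
  obtain ⟨A, -, hA, H⟩ := hU.signDetermined_realize φ
  refine H _ _ fun s g hg => ?_
  obtain ⟨t, ht⟩ := hA s g hg
  rw [← ht, ← ht]
  obtain ⟨f, f', hf, hff⟩ := hU.term_split t
  have key : ∀ i : Fin n → I₁ ⊕ₗ (Unit ⊕ₗ I₂), StrictMono i → ∃ i₀ : Fin n → I₁ ⊕ₗ I₂,
      StrictMono i₀ ∧ SignType.sign (t.eval U (U.blockVal a b i) : Car U s) =
        SignType.sign (t.eval U (U.blockVal (a ∘ skip) b i₀) : Car U s) := by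
    intro i hi
    obtain ⟨_, _, hs₁, hs₂, hc₁, hc₂, hbetween⟩ := exists_tuples_avoiding exists_lt_mid
      exists_between_mid_left exists_mid_lt exists_between_mid_right
      (fun i : Fin n → I₁ ⊕ₗ (Unit ⊕ₗ I₂) => f (fun q => a (i q.1) q.2))
      (fun κ κ' => hU.lt_iff_lt_of_indiscernible ha hf κ κ') i hi
    obtain ⟨i₁, hi₁, rfl⟩ := exists_strictMono_skip_comp_eq hs₁ hc₁
    obtain ⟨i₂, hi₂, rfl⟩ := exists_strictMono_skip_comp_eq hs₂ hc₂
    refine ⟨i₁, hi₁, ?_⟩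
    have h₁₂ := hU.sign_eq_of_indiscernibleOver hab t i₁ i₂ hi₁ hi₂
    have e : t.eval U (U.blockVal a b i) = f (fun q => a (i q.1) q.2) + f' b := hff _
    have e₁ : t.eval U (U.blockVal (a ∘ skip) b i₁) =
      f (fun q => a ((skip ∘ i₁) q.1) q.2) + f' b := hff _
    have e₂ : t.eval U (U.blockVal (a ∘ skip) b i₂) =
      f (fun q => a ((skip ∘ i₂) q.1) q.2) + f' b := hff _
    rw [e₁, e₂] at h₁₂
    rw [e, e₁]
    -- Translation by `f' b` preserves betweenness and `sign` is monotone, so equal signs at the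
    -- outer values force the middle one.
    rcases hbetween with ⟨hl, hr⟩ | ⟨hl, hr⟩
    · refine le_antisymm ?_ (SignType.sign.monotone (add_le_add_left hl _))
      rw [h₁₂]
      exact SignType.sign.monotone (add_le_add_left hr _)
    · refine le_antisymm (SignType.sign.monotone (add_le_add_left hr _)) ?_
      rw [h₁₂]
      exact SignType.sign.monotone (add_le_add_left hl _)
  obtain ⟨i₀, hi₀, e⟩ := key i hi
  obtain ⟨i₀', hi₀', e'⟩ := key i' hi'
  exact e.trans ((hU.sign_eq_of_indiscernibleOver hab t i₀ i₀' hi₀ hi₀').trans e'.symm)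

end Interprets

end Distal

end DensePair

theorem ManySorted.Struct.IndiscernibleOver.comp_strictMono {L : ManySorted.Lang.{u, x, x'}}
    {N : ManySorted.Struct.{u, x, x', w} L} {I : Type y} {J : Type z} [LinearOrder I]
    [LinearOrder J] {m k : ℕ} {σ : Fin m → L.Sorts} {ρ : Fin k → L.Sorts}
    {a : I → (j : Fin m) → N.carrier (σ j)} {b : (j : Fin k) → N.carrier (ρ j)}
    (h : N.IndiscernibleOver a b) {f : J → I} (hf : StrictMono f) :
    N.IndiscernibleOver (a ∘ f) b := fun n φ i i' hi hi' =>
  h n φ (f ∘ i) (f ∘ i') (hf.comp hi) (hf.comp hi')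

/-! ### First-order axioms and their transfer. -/

namespace DensePair

open ManySorted

section Sentences

variable {F : Type u} {V : Type} {τ : V → Srt}

/-- The context `τ` with one further variable of the sort `s`. -/
abbrev context (τ : V → Srt) (s : Srt) : Option V → Srt := extend τ s

/-- Universal quantification over the sort `s`. -/
def fall (s : Srt) (φ : Formula (LPrec F) (context τ s)) : Formula (LPrec F) τ :=
  .all (L := LPrec F) s φ

/-- Equality of two terms of the sort `s`. -/
def feq (s : Srt) (t₁ t₂ : Term (LPrec F) τ s) : Formula (LPrec F) τ := .equal t₁ t₂

/-- The last variable. -/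
def var₀ {s : Srt} : Term (LPrec F) (context τ s) s :=
  .var (L := LPrec F) (τ := context τ s) none

/-- The last but one variable. -/
def var₁ {s s' : Srt} : Term (LPrec F) (context (context τ s) s') s :=
  .var (L := LPrec F) (τ := context (context τ s) s') (some none)

/-- The last but two variable. -/
def var₂ {s s' s'' : Srt} : Term (LPrec F) (context (context (context τ s) s') s'') s :=
  .var (L := LPrec F) (τ := context (context (context τ s) s') s'') (some (some none))

variable (U : Struct.{0, u, 0, w} (LPrec F)) (e : (i : V) → Car U (τ i))

theorem realize_fall (s : Srt) (φ : Formula (LPrec F) (context τ s)) :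
    (fall s φ).Realize U e ↔ ∀ a : Car U s, φ.Realize U (extendAssign e a) := Iff.rfl

theorem realize_feq (s : Srt) (t₁ t₂ : Term (LPrec F) τ s) :
    (feq s t₁ t₂).Realize U e ↔ (t₁.eval U e : Car U s) = t₂.eval U e := Iff.rfl

theorem realize_imp (φ ψ : Formula (LPrec F) τ) :
    (Formula.imp φ ψ).Realize U e ↔ (φ.Realize U e → ψ.Realize U e) := Iff.rfl

theorem realize_falsum : (Formula.falsum : Formula (LPrec F) τ).Realize U e ↔ False := Iff.rfl

theorem eval_var₀ {s : Srt} (a : Car U s) :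
    (var₀ : Term (LPrec F) (context τ s) s).eval U (extendAssign e a) = a := rfl

theorem eval_var₁ {s s' : Srt} (a : Car U s) (b : Car U s') :
    (var₁ : Term (LPrec F) (context (context τ s) s') s).eval U
      (extendAssign (extendAssign e a) b) = a := rfl

theorem eval_var₂ {s s' s'' : Srt} (a : Car U s) (b : Car U s') (c : Car U s'') :
    (var₂ : Term (LPrec F) (context (context (context τ s) s') s'') s).eval U
      (extendAssign (extendAssign (extendAssign e a) b) c) = a := rfl

/-- Truth of a sentence. -/
def Holds (φ : Formula (LPrec F) (Empty.elim : Empty → Srt)) : Prop := U.Satisfies φ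

theorem holds_iff (φ : Formula (LPrec F) (Empty.elim : Empty → Srt)) :
    Holds U φ ↔ φ.Realize U (fun i : Empty => (i.elim : Car U (Empty.elim i))) := Iff.rfl

end Sentences

section Axioms

variable {F : Type u}

/-- The vector space axioms for the sort `s`. -/
structure VectorAxioms [Field F] (U : Struct.{0, u, 0, w} (LPrec F)) (s : Srt) : Prop where
  add_assoc (a b c : Car U s) : uadd U s (uadd U s a b) c = uadd U s a (uadd U s b c)
  add_comm (a b : Car U s) : uadd U s a b = uadd U s b a
  zero_add (a : Car U s) : uadd U s (uzero U s) a = a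
  neg_add (a : Car U s) : uadd U s (usmul U (-1) s a) a = uzero U s
  smul_add (α : F) (a b : Car U s) :
    usmul U α s (uadd U s a b) = uadd U s (usmul U α s a) (usmul U α s b)
  add_smul (α β : F) (a : Car U s) :
    usmul U (α + β) s a = uadd U s (usmul U α s a) (usmul U β s a)
  mul_smul (α β : F) (a : Car U s) : usmul U (α * β) s a = usmul U α s (usmul U β s a)
  one_smul (a : Car U s) : usmul U 1 s a = a

/-- The order axioms for the sort `s`. -/
structure OrderAxioms [Field F] [LinearOrder F] (U : Struct.{0, u, 0, w} (LPrec F)) (s : Srt) :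
    Prop where
  irrefl (a : Car U s) : ¬ult U s a a
  trans (a b c : Car U s) : ult U s a b → ult U s b c → ult U s a c
  connected (a b : Car U s) : ¬ult U s a b → ¬ult U s b a → a = b
  add_lt_add (a b c : Car U s) : ult U s a b → ult U s (uadd U s c a) (uadd U s c b)
  smul_lt_smul (α : F) (a b : Car U s) :
    0 < α → ult U s a b → ult U s (usmul U α s a) (usmul U α s b)

/-- The axioms for the quotient map by a proper dense subspace. -/
structure QuotientAxioms (U : Struct.{0, u, 0, w} (LPrec F)) : Prop where
  map_add (a b : Car U .home) : uproj U (uadd U .home a b) = uadd U .quot (uproj U a) (uproj U b)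
  map_smul (α : F) (a : Car U .home) : uproj U (usmul U α .home a) = usmul U α .quot (uproj U a)
  surjective (c : Car U .quot) : ¬∀ a, ¬uproj U a = c
  mem (a : Car U .home) : umem U a → uproj U a = uzero U .quot
  of_eq_zero (a : Car U .home) : uproj U a = uzero U .quot → umem U a
  dense (a b : Car U .home) : ult U .home a b →
    ¬∀ d, umem U d → ult U .home a d → ¬ult U .home d b
  proper : ¬∀ a, umem U a

section Transfer

variable {U : Struct.{0, u, 0, w} (LPrec F)} {U' : Struct.{0, u, 0, x} (LPrec F)}

/-- Each axiom is the realization of one sentence for each choice of scalars. No quantification over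
`F` inside the language is needed, because every scalar has its own function symbol. -/
theorem VectorAxioms.transfer (h : ∀ φ, Holds U φ → Holds U' φ)
    [Field F] {s : Srt} (H : VectorAxioms U s) :
    VectorAxioms U' s where
  add_assoc := by
    have := h (fall s (fall s (fall s (feq s (tadd s (tadd s var₂ var₁) var₀)
      (tadd s var₂ (tadd s var₁ var₀))))))
    simp only [holds_iff, realize_fall, realize_feq, eval_tadd, eval_var₀, eval_var₁,
      eval_var₂] at this
    exact this H.add_assoc
  add_comm := by
    have := h (fall s (fall s (feq s (tadd s var₁ var₀) (tadd s var₀ var₁))))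
    simp only [holds_iff, realize_fall, realize_feq, eval_tadd, eval_var₀, eval_var₁] at this
    exact this H.add_comm
  zero_add := by
    have := h (fall s (feq s (tadd s (tzero s) var₀) var₀))
    simp only [holds_iff, realize_fall, realize_feq, eval_tadd, eval_tzero, eval_var₀] at this
    exact this H.zero_add
  neg_add := by
    have := h (fall s (feq s (tadd s (tsmul (-1) s var₀) var₀) (tzero s)))
    simp only [holds_iff, realize_fall, realize_feq, eval_tadd, eval_tzero, eval_tsmul,
      eval_var₀] at this
    exact this H.neg_add
  smul_add α := by
    have := h (fall s (fall s (feq s (tsmul α s (tadd s var₁ var₀))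
      (tadd s (tsmul α s var₁) (tsmul α s var₀)))))
    simp only [holds_iff, realize_fall, realize_feq, eval_tadd, eval_tsmul, eval_var₀,
      eval_var₁] at this
    exact this (H.smul_add α)
  add_smul α β := by
    have := h (fall s (feq s (tsmul (α + β) s var₀) (tadd s (tsmul α s var₀) (tsmul β s var₀))))
    simp only [holds_iff, realize_fall, realize_feq, eval_tadd, eval_tsmul, eval_var₀] at this
    exact this (H.add_smul α β)
  mul_smul α β := by
    have := h (fall s (feq s (tsmul (α * β) s var₀) (tsmul α s (tsmul β s var₀))))
    simp only [holds_iff, realize_fall, realize_feq, eval_tsmul, eval_var₀] at this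
    exact this (H.mul_smul α β)
  one_smul := by
    have := h (fall s (feq s (tsmul 1 s var₀) var₀))
    simp only [holds_iff, realize_fall, realize_feq, eval_tsmul, eval_var₀] at this
    exact this H.one_smul

theorem OrderAxioms.transfer (h : ∀ φ, Holds U φ → Holds U' φ)
    [Field F] [LinearOrder F] {s : Srt} (H : OrderAxioms U s) :
    OrderAxioms U' s where
  irrefl := by
    have := h (fall s (.imp (flt s var₀ var₀) .falsum))
    simp only [holds_iff, realize_fall, realize_imp, realize_flt, realize_falsum,
      eval_var₀] at this
    exact this H.irrefl
  trans := by
    have := h (fall s (fall s (fall s (.imp (flt s var₂ var₁)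
      (.imp (flt s var₁ var₀) (flt s var₂ var₀))))))
    simp only [holds_iff, realize_fall, realize_imp, realize_flt, eval_var₀, eval_var₁,
      eval_var₂] at this
    exact this H.trans
  connected := by
    have := h (fall s (fall s (.imp (.imp (flt s var₁ var₀) .falsum)
      (.imp (.imp (flt s var₀ var₁) .falsum) (feq s var₁ var₀)))))
    simp only [holds_iff, realize_fall, realize_imp, realize_flt, realize_falsum, realize_feq,
      eval_var₀, eval_var₁] at this
    exact this H.connected
  add_lt_add := by
    have := h (fall s (fall s (fall s (.imp (flt s var₂ var₁)
      (flt s (tadd s var₀ var₂) (tadd s var₀ var₁))))))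
    simp only [holds_iff, realize_fall, realize_imp, realize_flt, eval_tadd, eval_var₀, eval_var₁,
      eval_var₂] at this
    exact this H.add_lt_add
  smul_lt_smul α a b hα := by
    have := h (fall s (fall s (.imp (flt s var₁ var₀)
      (flt s (tsmul α s var₁) (tsmul α s var₀)))))
    simp only [holds_iff, realize_fall, realize_imp, realize_flt, eval_tsmul, eval_var₀,
      eval_var₁] at this
    exact this (fun a b => H.smul_lt_smul α a b hα) a b

/-- The axioms express existence as `¬∀ ¬` because formulas are built from `⊥`, implication and `∀`;
the unfolded sentence is then the axiom itself. -/
theorem QuotientAxioms.transfer (h : ∀ φ, Holds U φ → Holds U' φ)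
    (H : QuotientAxioms U) : QuotientAxioms U' where
  map_add := by
    have := h (fall .home (fall .home (feq .quot (tproj (tadd .home var₁ var₀))
      (tadd .quot (tproj var₁) (tproj var₀)))))
    simp only [holds_iff, realize_fall, realize_feq, eval_tadd, eval_tproj, eval_var₀,
      eval_var₁] at this
    exact this H.map_add
  map_smul α := by
    have := h (fall .home (feq .quot (tproj (tsmul α .home var₀)) (tsmul α .quot (tproj var₀))))
    simp only [holds_iff, realize_fall, realize_feq, eval_tsmul, eval_tproj, eval_var₀] at this
    exact this (H.map_smul α)
  surjective := by
    have := h (fall .quot (.imp (fall .home (.imp (feq .quot (tproj var₀) var₁) .falsum)) .falsum))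
    simp only [holds_iff, realize_fall, realize_feq, realize_imp, realize_falsum, eval_tproj,
      eval_var₀, eval_var₁] at this
    exact this H.surjective
  mem := by
    have := h (fall .home (.imp (fmem var₀) (feq .quot (tproj var₀) (tzero .quot))))
    simp only [holds_iff, realize_fall, realize_feq, realize_imp, realize_fmem, eval_tproj,
      eval_tzero, eval_var₀] at this
    exact this H.mem
  of_eq_zero := by
    have := h (fall .home (.imp (feq .quot (tproj var₀) (tzero .quot)) (fmem var₀)))
    simp only [holds_iff, realize_fall, realize_feq, realize_imp, realize_fmem, eval_tproj,
      eval_tzero, eval_var₀] at this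
    exact this H.of_eq_zero
  dense := by
    have := h (fall .home (fall .home (.imp (flt .home var₁ var₀)
      (.imp (fall .home (.imp (fmem var₀) (.imp (flt .home var₂ var₀)
        (.imp (flt .home var₀ var₁) .falsum)))) .falsum))))
    simp only [holds_iff, realize_fall, realize_imp, realize_fmem, realize_flt, realize_falsum,
      eval_var₀, eval_var₁, eval_var₂] at this
    exact this H.dense
  proper := by
    have := h (.imp (fall .home (fmem var₀)) .falsum)
    simp only [holds_iff, realize_fall, realize_imp, realize_fmem, realize_falsum,
      eval_var₀] at this
    exact this H.proper

end Transfer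

end Axioms

end DensePair

/-! ### From the axioms to ordered vector spaces and distality. -/

namespace DensePair

open ManySorted

section Models

variable {F : Type u} [Field F] {U : Struct.{0, u, 0, w} (LPrec F)}

/-- The additive group on a sort satisfying the vector space axioms. -/
abbrev VectorAxioms.addCommGroup {s : Srt} (H : VectorAxioms U s) : AddCommGroup (Car U s) :=
  letI : Add (Car U s) := ⟨uadd U s⟩
  letI : Zero (Car U s) := ⟨uzero U s⟩
  letI : Neg (Car U s) := ⟨usmul U (-1) s⟩
  { AddGroup.ofLeftAxioms H.add_assoc H.zero_add H.neg_add with add_comm := H.add_comm }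

/-- The vector space structure on a sort satisfying the vector space axioms. -/
abbrev VectorAxioms.module {s : Srt} (H : VectorAxioms U s) :
    letI := H.addCommGroup
    Module F (Car U s) :=
  letI := H.addCommGroup
  letI : SMul F (Car U s) := ⟨fun α a => usmul U α s a⟩
  Module.ofMinimalAxioms H.smul_add H.add_smul H.mul_smul H.one_smul

variable [LinearOrder F]

/-- The linear order on a sort satisfying the order axioms. -/
noncomputable abbrev OrderAxioms.linearOrder {s : Srt} (H : OrderAxioms U s) :
    LinearOrder (Car U s) :=
  haveI : IsStrictTotalOrder (Car U s) (ult U s) :=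
    { irrefl := H.irrefl, trans := H.trans, trichotomous := H.connected }
  letI := Classical.decRel (ult U s)
  linearOrderOfSTO (ult U s)

variable [IsStrictOrderedRing F]

theorem indiscernibleOver_of_skip_of_axioms (hv : ∀ s, VectorAxioms U s)
    (ho : ∀ s, OrderAxioms U s) (hq : QuotientAxioms U)
    {I₁ : Type y} {I₂ : Type z} [LinearOrder I₁] [LinearOrder I₂]
    [Nonempty I₁] [NoMaxOrder I₁] [Nonempty I₂] [NoMinOrder I₂] {m : ℕ} {σ : Fin m → Srt}
    {a : I₁ ⊕ₗ (Unit ⊕ₗ I₂) → (j : Fin m) → Car U (σ j)} (ha : U.Indiscernible a) {k : ℕ}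
    {ρ : Fin k → Srt} {b : (j : Fin k) → Car U (ρ j)}
    (hab : U.IndiscernibleOver (a ∘ skip) b) : U.IndiscernibleOver a b := by
  let : ∀ s, AddCommGroup (Car U s) := fun s => (hv s).addCommGroup
  let : ∀ s, Module F (Car U s) := fun s => (hv s).module
  let : ∀ s, LinearOrder (Car U s) := fun s => (ho s).linearOrder
  have : ∀ s, IsOrderedAddMonoid (Car U s) := fun s =>
    { add_le_add_left := fun a b hab c => by
        rcases hab.eq_or_lt with rfl | hab
        · exact le_rfl
        · rw [add_comm a, add_comm b]
          exact le_of_lt (show c + a < c + b from (ho s).add_lt_add a b c hab) }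
  have : ∀ s, IsStrictOrderedModule F (Car U s) := fun s =>
    isStrictOrderedModule_of_smul_lt_smul (ho s).smul_lt_smul
  let p : Car U Srt.home →ₗ[F] Car U Srt.quot :=
    { toFun := uproj U, map_add' := hq.map_add, map_smul' := hq.map_smul }
  have : ∀ s, Nontrivial (Car U s) := fun s => by
    obtain ⟨d, hd⟩ := not_forall.1 hq.proper
    have hd : p d ≠ 0 := fun h => hd (hq.of_eq_zero d h)
    cases s with
    | quot => exact ⟨p d, 0, hd⟩
    | home => exact ⟨d, 0, fun h => hd (by rw [h, map_zero])⟩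
  have hU : Interprets U p :=
    { zero := fun _ => rfl
      add := fun _ _ _ => rfl
      smul := fun _ _ _ => rfl
      proj := fun _ => rfl
      mem := fun d => ⟨hq.mem d, hq.of_eq_zero d⟩
      lt := fun _ _ _ => Iff.rfl
      dense := fun d₁ d₂ c hd => by
        -- The fibre over `c` is the translate of the subspace by a representative `e`, so its
        -- density follows by shifting the interval.
        obtain ⟨e, he⟩ := not_forall_not.1 (hq.surjective c)
        have hlt : d₁ - e < d₂ - e := sub_lt_sub_right hd e
        have H := hq.dense _ _ hlt
        push Not at H
        obtain ⟨f, hf, h₁, h₂⟩ := H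
        have h₁ : d₁ - e < f := h₁
        have h₂ : f < d₂ - e := h₂
        have hf : p f = 0 := hq.mem f hf
        refine ⟨f + e, sub_lt_iff_lt_add.1 h₁, lt_sub_iff_add_lt.1 h₂, ?_⟩
        rw [map_add, hf, zero_add]
        exact he }
  exact hU.indiscernibleOver_of_skip ha hab

theorem isDistal_of_axioms {N : Struct.{0, u, 0, x} (LPrec F)} (hv : ∀ s, VectorAxioms N s)
    (ho : ∀ s, OrderAxioms N s) (hq : QuotientAxioms N) :
    Theory.IsDistal.{0, u, 0, w, y, z} N.theory := by
  intro U hU I₁ I₂ _ _ _ _ _ _ _ _ m σ a ha k ρ b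
  have h : ∀ φ, Holds N φ → Holds U φ := hU
  exact ⟨indiscernibleOver_of_skip_of_axioms (fun s => (hv s).transfer h)
    (fun s => (ho s).transfer h) (hq.transfer h) ha, fun hab => hab.comp_strictMono strictMono_skip⟩

end Models

/-! ### The axioms for the pair and for its expansions. -/

section Expansions

variable {F : Type u}

/-- These axioms do not mention `≺`. They can be transferred from the pair to `N` with `≺` empty and
then read in any other expansion. -/
theorem QuotientAxioms.expand_congr {N : Struct.{0, u, 0, x} (LStar F)}
    {R R' : N.carrier Srt.quot → N.carrier Srt.quot → Prop}
    (h : QuotientAxioms (expand N R)) : QuotientAxioms (expand N R') :=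
  ⟨h.1, h.2, h.3, h.4, h.5, h.6, h.7⟩

variable [Field F]

theorem VectorAxioms.expand_congr {N : Struct.{0, u, 0, x} (LStar F)}
    {R R' : N.carrier Srt.quot → N.carrier Srt.quot → Prop} {s : Srt}
    (h : VectorAxioms (expand N R) s) : VectorAxioms (expand N R') s := by
  cases s <;> exact ⟨h.1, h.2, h.3, h.4, h.5, h.6, h.7, h.8⟩

theorem OrderAxioms.expand_congr [LinearOrder F] {N : Struct.{0, u, 0, x} (LStar F)}
    {R R' : N.carrier Srt.quot → N.carrier Srt.quot → Prop}
    (h : OrderAxioms (expand N R) Srt.home) : OrderAxioms (expand N R') Srt.home :=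
  ⟨h.1, h.2, h.3, h.4, h.5⟩

theorem OrdersQuotient.orderAxioms [LinearOrder F] {N : Struct.{0, u, 0, x} (LStar F)}
    {prec : N.carrier Srt.quot → N.carrier Srt.quot → Prop} (h : OrdersQuotient N prec) :
    OrderAxioms (expand N prec) Srt.quot := by
  obtain ⟨_, _, _, _, _, -, hadd, hsmul, hlt⟩ := h
  have hlt : ∀ p q : N.carrier Srt.quot, ult (expand N prec) Srt.quot p q ↔ p < q := hlt
  have hadd : ∀ p q : N.carrier Srt.quot, uadd (expand N prec) Srt.quot p q = p + q := hadd
  have hsmul : ∀ (α : F) (p : N.carrier Srt.quot),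
    usmul (expand N prec) α Srt.quot p = α • p := hsmul
  constructor
  · exact fun (a : N.carrier Srt.quot) h => lt_irrefl a ((hlt a a).1 h)
  · exact fun (a b c : N.carrier Srt.quot) h h' =>
      (hlt a c).2 (((hlt a b).1 h).trans ((hlt b c).1 h'))
  · exact fun (a b : N.carrier Srt.quot) h h' =>
      le_antisymm (α := N.carrier Srt.quot) (not_lt.1 fun H => h' ((hlt b a).2 H))
        (not_lt.1 fun H => h ((hlt a b).2 H))
  · intro (a : N.carrier Srt.quot) (b : N.carrier Srt.quot) (c : N.carrier Srt.quot) h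
    rw [hadd c a, hadd c b]
    exact (hlt _ _).2 (add_lt_add_right ((hlt a b).1 h) c)
  · intro α (a : N.carrier Srt.quot) (b : N.carrier Srt.quot) hα h
    rw [hsmul α a, hsmul α b]
    exact (hlt _ _).2 (smul_lt_smul_of_pos_left ((hlt a b).1 h) hα)

section Pair

variable {M : Type x} [AddCommGroup M] [Module F M] (one : M) (Q : Submodule F M)

theorem vectorAxioms_pairStruct [LT M] (R) (s : Srt) :
    VectorAxioms (expand (pairStruct one Q) R) s := by
  cases s with
  | home =>
    exact
      { add_assoc := add_assoc (G := M)
        add_comm := add_comm (G := M)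
        zero_add := zero_add (M := M)
        neg_add := fun a : M => by
          change (-1 : F) • a + a = 0
          rw [neg_one_smul, neg_add_cancel]
        smul_add := smul_add (M := F) (A := M)
        add_smul := add_smul (R := F) (M := M)
        mul_smul := mul_smul (α := F) (β := M)
        one_smul := one_smul F (α := M) }
  | quot =>
    exact
      { add_assoc := add_assoc (G := M ⧸ Q)
        add_comm := add_comm (G := M ⧸ Q)
        zero_add := fun a : M ⧸ Q => by
          change Q.mkQ 0 + a = a
          rw [map_zero, zero_add]
        neg_add := fun a : M ⧸ Q => by
          change (-1 : F) • a + a = Q.mkQ 0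
          rw [neg_one_smul, neg_add_cancel, map_zero]
        smul_add := smul_add (M := F) (A := M ⧸ Q)
        add_smul := add_smul (R := F) (M := M ⧸ Q)
        mul_smul := mul_smul (α := F) (β := M ⧸ Q)
        one_smul := one_smul F (α := M ⧸ Q) }

variable [LinearOrder M]

theorem orderAxioms_pairStruct [LinearOrder F] [IsOrderedAddMonoid M] [IsStrictOrderedModule F M]
    (R) : OrderAxioms (expand (pairStruct one Q) R) Srt.home where
  irrefl := lt_irrefl (α := M)
  trans := fun _ _ _ : M => lt_trans
  connected := fun (_ _ : M) h h' => le_antisymm (α := M) (not_lt.1 h') (not_lt.1 h)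
  add_lt_add := fun (a b c : M) (h : a < b) => (add_lt_add_right h c : c + a < c + b)
  smul_lt_smul := fun α (a b : M) hα (h : a < b) =>
    (smul_lt_smul_of_pos_left h hα : α • a < α • b)

theorem quotientAxioms_pairStruct (proper : Q ≠ ⊤)
    (dense : ∀ a b : M, a < b → ∃ q ∈ Q, a < q ∧ q < b) (R) :
    QuotientAxioms (expand (pairStruct one Q) R) where
  map_add := map_add Q.mkQ
  map_smul := map_smul Q.mkQ
  surjective c := not_forall_not.2 (Q.mkQ_surjective c)
  mem := fun (a : M) (h : a ∈ Q) => by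
    change Q.mkQ a = Q.mkQ 0
    rw [map_zero]
    exact (Submodule.Quotient.mk_eq_zero Q).2 h
  of_eq_zero := fun (a : M) h => by
    have h : Q.mkQ a = Q.mkQ 0 := h
    rw [map_zero] at h
    exact (Submodule.Quotient.mk_eq_zero Q).1 h
  dense := fun (a b : M) h H => by
    obtain ⟨q, hq, h₁, h₂⟩ := dense a b h
    exact H q hq h₁ h₂
  proper h := proper (eq_top_iff.2 fun a _ => h a)

end Pair

end Expansions

end DensePair

theorem mainTheorem4
    {F : Type u} [Field F] [LinearOrder F] [IsStrictOrderedRing F]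
    {M : Type x} [AddCommGroup M] [LinearOrder M] [IsOrderedAddMonoid M]
    [Module F M] [IsStrictOrderedModule F M]
    (one : M) (one_pos : 0 < one)
    (Q : Submodule F M) (one_mem : one ∈ Q) (proper : Q ≠ ⊤)
    (dense : ∀ a b : M, a < b → ∃ q ∈ Q, a < q ∧ q < b)
    (N : ManySorted.Struct.{0, u, 0, x'} (DensePair.LStar F))
    (hN : N.IsModel (DensePair.pairStruct one Q).theory) :
    (∀ prec : N.carrier DensePair.Srt.quot → N.carrier DensePair.Srt.quot → Prop,
      DensePair.OrdersQuotient N prec →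
        ManySorted.Theory.IsDistal.{0, u, 0, w, y, z} (DensePair.expand N prec).theory) ∧
    (∃ prec : N.carrier DensePair.Srt.quot → N.carrier DensePair.Srt.quot → Prop,
      DensePair.OrdersQuotient N prec ∧
        ManySorted.Theory.IsDistal.{0, u, 0, w, y, z} (DensePair.expand N prec).theory) := by
  -- `N` is only known to share the `L*`-theory of the pair. With `≺` empty on both sides this
  -- becomes a transfer in the larger language, where the axioms are stated.
  have h : ∀ φ, DensePair.Holds (DensePair.expand (DensePair.pairStruct one Q) fun _ _ => False) φ →
      DensePair.Holds (DensePair.expand N fun _ _ => False) φ :=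
    ManySorted.Struct.satisfies_addBinary_empty (L := DensePair.LStar F) DensePair.Srt.quot hN
  have hv := fun s => (DensePair.vectorAxioms_pairStruct one Q _ s).transfer h
  have ho := (DensePair.orderAxioms_pairStruct one Q _).transfer h
  have hq := (DensePair.quotientAxioms_pairStruct one Q proper dense _).transfer h
  have distal : ∀ prec : N.carrier DensePair.Srt.quot → N.carrier DensePair.Srt.quot → Prop,
      DensePair.OrdersQuotient N prec →
        ManySorted.Theory.IsDistal.{0, u, 0, w, y, z} (DensePair.expand N prec).theory :=
    fun prec hprec => DensePair.isDistal_of_axioms (fun s => (hv s).expand_congr)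
      (fun s => match s with
        | .home => ho.expand_congr
        | .quot => hprec.orderAxioms)
      hq.expand_congr
  refine ⟨distal, ?_⟩
  let : AddCommGroup (N.carrier DensePair.Srt.quot) := (hv .quot).addCommGroup
  let : Module F (N.carrier DensePair.Srt.quot) := (hv .quot).module
  obtain ⟨_, _, _⟩ := exists_linearOrder_isStrictOrderedModule (F := F)
    (N.carrier DensePair.Srt.quot)
  -- The group and module structures were built from `+_Q` and the maps `α_Q`, so compatibility
  -- holds by definition.
  have hprec : DensePair.OrdersQuotient N (· < ·) :=
    ⟨inferInstance, inferInstance, inferInstance, inferInstance, inferInstance,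
      denselyOrdered_of_isStrictOrderedModule F _, fun _ _ => rfl, fun _ _ => rfl,
      fun _ _ => Iff.rfl⟩
  exact ⟨_, hprec, distal _ hprec⟩
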